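/- Let $N$ be a connected finite-dimensional smooth manifold (Hausdorff, second countable, without boundary), $C^\infty(N)$ the smooth complex valued functions and $\operatorname{Vect}(N)$ the complexified space of smooth vector fields on $N$. For each $\lambda\in N$ let $\mathcal H(\lambda)$ be a complex Hilbert space, with inner product antilinear in the second variable; a section over an open set $U\subseteq N$ is a map $\varphi$ with $\varphi(\lambda)\in\mathcal H(\lambda)$ for $\lambda\in U$, and $h(\varphi,\psi)(\lambda)=\langle\varphi(\lambda),\psi(\lambda)\rangle_\lambda$. Let $(H\to N,\Gamma^\infty,\nabla)$ be a smooth field of Hilbert spaces: $\Gamma^\infty$ is a set of sections over $N$ closed under addition and under multiplication by $C^\infty(N)$, and $\nabla:\operatorname{Vect}(N)\times\Gamma^\infty\to\Gamma^\infty$ satisfies, for all $X,Y\in\operatorname{Vect}(N)$, $a\in C^\infty(N)$, $\varphi,\psi\in\Gamma^\infty$, (i) $\nabla_{X+Y}=\nabla_X+\nabla_Y$, $\nabla_{aX}=a\nabla_X$, $\nabla_X(a\varphi)=X(a)\varphi+a\nabla_X\varphi$; (ii) $h(\varphi,\psi)\in C^\infty(N)$ and $Xh(\varphi,\psi)=h(\nabla_X\varphi,\psi)+h(\varphi,\nabla_{\overline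 X}\psi)$; (iii) $\{\varphi(\lambda):\varphi\in\Gamma^\infty\}$ is dense in $\mathcal H(\lambda)$ for every $\lambda\in N$. For $U\subseteq N$ open, $X\in\operatorname{Vect}(U)$ and $\varphi\in\Gamma^\infty$, let $\nabla_X\varphi$ on $U$ be given by $(\nabla_X\varphi)(\lambda)=(\nabla_Y\varphi)(\lambda)$ for any $Y\in\operatorname{Vect}(N)$ with $Y(\lambda)=X(\lambda)$. Let $\Gamma^0(U)$ be the set of sections over $U$ that are locally uniform limits on $U$ of sequences in $\Gamma^\infty$. Let $\Gamma^1(U)$ be the set of $\varphi\in\Gamma^0(U)$ for which there is a sequence $(\varphi_j)$ in $\Gamma^\infty$ with $\varphi_j\to\varphi$ locally uniformly on $U$ and such that $\nabla_X\varphi_j$ converges locally uniformly on $U$ for every $X\in\operatorname{Vect}(U)$; then $\nabla_X\varphi:=\lim_j\nabla_X\varphi_j$. For $n\ge2$, $\varphi\in\Gamma^n(U)$ iff $\varphi\in\Gamma^{n-1}(U)$ and $\nabla_X\varphi\in\Gamma^{n-1}(U)$ for all $X\in\operatorname{Vect}(U)$, and $\Gamma^\infty(U)=\bigcap_n\Gamma^n(U)$.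 The topology induced by $\Gamma^n(U)$ on $\Gamma^\infty(U)$ is that of the seminorms $\sup_{\lambda\in C}\|\nabla_{X_1}\cdots\nabla_{X_m}\varphi(\lambda)\|$, with $C\subseteq U$ compact, $0\le m\le n$ and $X_1,\dots,X_m\in\operatorname{Vect}(U)$. A $\Gamma^\infty(U)$-smooth field of operators is a family $A=\{A(\lambda)\}_{\lambda\in U}$ of linear operators in $\mathcal H(\lambda)$ such that the domains of $A(\lambda)$ and of $A(\lambda)^*$ contain $\{\varphi(\lambda):\varphi\in\Gamma^\infty(U)\}$ and such that $A$ and $A^*$, acting pointwise on sections, map $\Gamma^\infty(U)$ into $\Gamma^\infty(U)$. **Theorem.** Suppose that every point of $N$ has an open neighborhood $U$ with a family $\{A(X)\}_{X\in\operatorname{Vect}(U)}$ of $\Gamma^\infty(U)$-smooth fields of operators such that, as operators on $\Gamma^\infty(U)$: a) $A(X+Y)=A(X)+A(Y)$, $A(aX)=aA(X)$ and $\langle A(X)\varphi,\psi\rangle=\langle\varphi,-A(\overline X)\psi\rangle$ for all $X,Y\in\operatorname{Vect}(U)$, $a\in C^\infty(U)$, $\varphi,\psi\in\Gamma^\infty(U)$;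 b) $A(X):\Gamma^\infty(U)\to\Gamma^\infty(U)$ is continuous for the topology induced by $\Gamma^n(U)$, for every $X\in\operatorname{Vect}(U)$ and every integer $n\ge1$; c) for every $\lambda\in U$ and $v\in\mathcal H(\lambda)$ there is $\varphi\in\Gamma^\infty(U)$ with $\varphi(\lambda)=v$ and $\nabla_X\varphi=A(X)\varphi$ for every $X\in\operatorname{Vect}(U)$. Then $(H\to N,\Gamma^\infty,\nabla)$ admits a smooth local trivialization: there are an open cover $\{U_i\}_{i\in I}$ of $N$, Hilbert spaces $\{\mathcal H_i\}_{i\in I}$ and unitary operators $T_i(\lambda):\mathcal H(\lambda)\to\mathcal H_i$ $(\lambda\in U_i)$ such that $T_i(\Gamma^\infty(U_i))=C^\infty(U_i,\mathcal H_i)$ for every $i\in I$, where $(T_i\varphi)(\lambda)=T_i(\lambda)\varphi(\lambda)$. -/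

import Mathlib

open scoped Manifold ContDiff Topology InnerProductSpace LinearPMap
open TopologicalSpace (Opens)
open Filter

namespace HilbertField

noncomputable section

set_option linter.unusedSectionVars false

/-! ### Complexified vector fields -/

section VectorFields

variable (E : Type*) [NormedAddCommGroup E] [NormedSpace ℝ E]
  (M : Type*) [TopologicalSpace M] [ChartedSpace E M] [IsManifold 𝓘(ℝ, E) ∞ M]

/-- The space of smooth (real) vector fields on `M`. -/
abbrev RealVect : Type _ :=
  Cₛ^∞⟮𝓘(ℝ, E); E, (TangentSpace 𝓘(ℝ, E) : M → Type _)⟯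

/-- `Vect(M)`: the complexified space of smooth vector fields, i.e. `X = re + i im` with `re`, `im`
smooth real vector fields on `M`. -/
@[ext] structure Vect where
  re : RealVect E M
  im : RealVect E M

/-- `C^∞(M)`: the algebra of smooth complex valued functions. -/
abbrev SmoothFun : Type _ := C^∞⟮𝓘(ℝ, E), M; 𝓘(ℝ, ℂ), ℂ⟯

variable {E M}

/-- The product of a smooth real function and a smooth real vector field. -/
def RealVect.fsmul (a : M → ℝ) (ha : ContMDiff 𝓘(ℝ, E) 𝓘(ℝ, ℝ) ∞ a) (X : RealVect E M) :
    RealVect E M :=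
  ⟨a • (X : ∀ x, TangentSpace 𝓘(ℝ, E) x), ha.smul_section X.contMDiff⟩

theorem SmoothFun.contMDiff_re (a : SmoothFun E M) :
    ContMDiff 𝓘(ℝ, E) 𝓘(ℝ, ℝ) ∞ (fun x => (a x).re) :=
  Complex.reCLM.contDiff.contMDiff.comp a.contMDiff

theorem SmoothFun.contMDiff_im (a : SmoothFun E M) :
    ContMDiff 𝓘(ℝ, E) 𝓘(ℝ, ℝ) ∞ (fun x => (a x).im) :=
  Complex.imCLM.contDiff.contMDiff.comp a.contMDiff

instance : Add (Vect E M) := ⟨fun X Y => ⟨X.re + Y.re, X.im + Y.im⟩⟩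

/-- `(a + ib)(Y + iZ) = (aY - bZ) + i(aZ + bY)`. -/
instance : SMul (SmoothFun E M) (Vect E M) :=
  ⟨fun a X =>
    ⟨RealVect.fsmul _ a.contMDiff_re X.re - RealVect.fsmul _ a.contMDiff_im X.im,
      RealVect.fsmul _ a.contMDiff_re X.im + RealVect.fsmul _ a.contMDiff_im X.re⟩⟩

/-- The complex conjugate vector field. -/
def Vect.conj (X : Vect E M) : Vect E M := ⟨X.re, -X.im⟩

/-- The derivative `X f` of a complex valued function along a complex vector field. -/
def Vect.deriv (X : Vect E M) (f : M → ℂ) (x : M) : ℂ :=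
  let df : TangentSpace 𝓘(ℝ, E) x → ℂ := fun v => mfderiv 𝓘(ℝ, E) 𝓘(ℝ, ℂ) f x v
  df (X.re x) + Complex.I * df (X.im x)

/-- The vector field `Y` on `M` has, at the point `x` of the open set `U`, the same value as the
vector field `X` on `U`; tangent spaces are identified by the differential of the inclusion. -/
def Vect.AgreeAt {U : Opens M} (X : Vect E U) (Y : Vect E M) (x : U) : Prop :=
  Y.re (x : M) = mfderiv 𝓘(ℝ, E) 𝓘(ℝ, E) (Subtype.val : U → M) x (X.re x) ∧
  Y.im (x : M) = mfderiv 𝓘(ℝ, E) 𝓘(ℝ, E) (Subtype.val : U → M) x (X.im x)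

end VectorFields

/-! ### Smooth fields of Hilbert spaces -/

/-- A smooth structure (with connection `nabla`) on the field of Hilbert spaces `(H x)_{x ∈ N}`.
Mathlib's inner product is antilinear in the first variable, so that the function `h(φ, ψ)`, which
is antilinear in `ψ`, is `x ↦ ⟪ψ x, φ x⟫_ℂ`. -/
structure SmoothField (E : Type*) [NormedAddCommGroup E] [NormedSpace ℝ E]
    (N : Type*) [TopologicalSpace N] [ChartedSpace E N] [IsManifold 𝓘(ℝ, E) ∞ N]
    (H : N → Type*) [∀ x, NormedAddCommGroup (H x)] [∀ x, InnerProductSpace ℂ (H x)] where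
  /-- the distinguished set `Γ^∞` of sections -/
  Γ : Set (∀ x, H x)
  add_mem : ∀ φ ∈ Γ, ∀ ψ ∈ Γ, φ + ψ ∈ Γ
  smul_mem : ∀ (a : SmoothFun E N), ∀ φ ∈ Γ, (fun x => a x • φ x) ∈ Γ
  /-- the connection -/
  nabla : Vect E N → Γ → Γ
  nabla_add : ∀ (X Y : Vect E N) (φ : Γ),
    (nabla (X + Y) φ).1 = (nabla X φ).1 + (nabla Y φ).1
  nabla_smul : ∀ (a : SmoothFun E N) (X : Vect E N) (φ : Γ),
    (nabla (a • X) φ).1 = fun x => a x • (nabla X φ).1 x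
  leibniz : ∀ (a : SmoothFun E N) (X : Vect E N) (φ : Γ),
    (nabla X ⟨fun x => a x • φ.1 x, smul_mem a φ.1 φ.2⟩).1 =
      fun x => X.deriv a x • φ.1 x + a x • (nabla X φ).1 x
  smooth_inner : ∀ φ ∈ Γ, ∀ ψ ∈ Γ,
    ContMDiff 𝓘(ℝ, E) 𝓘(ℝ, ℂ) ∞ (fun x => ⟪ψ x, φ x⟫_ℂ)
  deriv_inner : ∀ (X : Vect E N) (φ ψ : Γ) (x : N),
    X.deriv (fun y => ⟪ψ.1 y, φ.1 y⟫_ℂ) x =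
      ⟪ψ.1 x, (nabla X φ).1 x⟫_ℂ + ⟪(nabla X.conj ψ).1 x, φ.1 x⟫_ℂ
  dense : ∀ x, Dense {v : H x | ∃ φ ∈ Γ, φ x = v}

section Sections

variable {E : Type*} [NormedAddCommGroup E] [NormedSpace ℝ E]
  {N : Type*} [TopologicalSpace N] [ChartedSpace E N] [IsManifold 𝓘(ℝ, E) ∞ N]
  {H : N → Type*} [∀ x, NormedAddCommGroup (H x)] [∀ x, InnerProductSpace ℂ (H x)]

/-- Locally uniform convergence on `U` of a sequence of sections of `H|_U`. -/
def LocUnifLim {U : Opens N} (s : ℕ → ∀ x : U, H x) (φ : ∀ x : U, H x) : Prop :=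
  TendstoLocallyUniformly (fun k (x : U) => ‖s k x - φ x‖) (fun _ => (0 : ℝ)) atTop

namespace SmoothField

variable (S : SmoothField E N H) (U : Opens N)

open Classical in
/-- The restricted connection: `∇_X φ` on `U`, for `X ∈ Vect(U)` and `φ ∈ Γ^∞`. Since `∇_Y φ (x)`
depends only on the value of `Y` at `x`, it is computed at `x` by means of any `Y ∈ Vect(N)`
with the same value as `X` at `x` (which exists on a Hausdorff finite-dimensional manifold). -/
def nablaRes (X : Vect E U) (φ : S.Γ) : ∀ x : U, H x := fun x =>
  if h : ∃ Y : Vect E N, X.AgreeAt Y x then (S.nabla h.choose φ).1 x else 0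

/-- `Γ^0(U)`: locally uniform limits on `U` of sequences in `Γ^∞`. -/
def Gamma0 : Set (∀ x : U, H x) :=
  {φ | ∃ s : ℕ → S.Γ, LocUnifLim (fun k x => (s k).1 x) φ}

/-- There is a sequence in `Γ^∞` which converges to `φ` locally uniformly on `U` and whose
derivatives along each `X ∈ Vect(U)` converge locally uniformly on `U` to `D X`. -/
def IsDeriv (φ : ∀ x : U, H x) (D : Vect E U → ∀ x : U, H x) : Prop :=
  ∃ s : ℕ → S.Γ, LocUnifLim (fun k x => (s k).1 x) φ ∧
    ∀ X : Vect E U, LocUnifLim (fun k => S.nablaRes U X (s k)) (D X)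

open Classical in
/-- The extended connection `∇_X φ = lim ∇_X φ_k` (the limit is independent of the sequence);
by convention it is `0` if `φ` is not once differentiable. -/
def nablaExt (X : Vect E U) (φ : ∀ x : U, H x) : ∀ x : U, H x :=
  if h : ∃ D, S.IsDeriv U φ D then h.choose X else 0

/-- `Γ^n(U)`: the `n` times differentiable sections over `U`. -/
def Gamma : ℕ → Set (∀ x : U, H x)
  | 0 => S.Gamma0 U
  | 1 => {φ | φ ∈ S.Gamma0 U ∧ ∃ D, S.IsDeriv U φ D}
  | n + 2 => {φ | φ ∈ Gamma (n + 1) ∧ ∀ X : Vect E U, S.nablaExt U X φ ∈ Gamma (n + 1)}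

/-- `Γ^∞(U)`. -/
def GammaInf : Set (∀ x : U, H x) := ⋂ n, S.Gamma U n

/-- `∇_{X_1} ⋯ ∇_{X_m} φ`. -/
def iterNabla : List (Vect E U) → (∀ x : U, H x) → ∀ x : U, H x
  | [], φ => φ
  | X :: L, φ => S.nablaExt U X (iterNabla L φ)

/-- The topology on `Γ^∞(U)` induced by that of `Γ^n(U)`. It is generated by the balls
`{ψ | ‖ψ - φ‖_{C, X_1, …, X_m} < ε}` of the seminorms
`‖φ‖_{C, X_1, …, X_m} = sup_{x ∈ C} ‖∇_{X_1} ⋯ ∇_{X_m} φ (x)‖`, `C ⊆ U` compact, `m ≤ n`. -/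
@[reducible] def topGamma (n : ℕ) : TopologicalSpace (S.GammaInf U) :=
  TopologicalSpace.generateFrom
    {B | ∃ (φ : S.GammaInf U) (C : Set U) (L : List (Vect E U)) (ε : ℝ),
      IsCompact C ∧ L.length ≤ n ∧ 0 < ε ∧
      B = {ψ | ∀ x ∈ C, ‖S.iterNabla U L (ψ.1 - φ.1) x‖ < ε}}

/-- A smooth field of operators `A = (A x)_{x ∈ U}` on `(H|_U, Γ^∞(U))`: each `A x` is an operator
in `H x` with domain; the domains of `A x` and of its adjoint contain the values at `x` of
the elements of `Γ^∞(U)`, and both `A` and its adjoint map `Γ^∞(U)` into itself. -/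
structure IsSmoothOp [∀ x, CompleteSpace (H x)] (A : ∀ x : U, H x →ₗ.[ℂ] H x) : Prop where
  mem_domain : ∀ φ ∈ S.GammaInf U, ∀ x, φ x ∈ (A x).domain
  mem_domain_adj : ∀ φ ∈ S.GammaInf U, ∀ x, φ x ∈ ((A x)†).domain
  map_mem : ∀ (φ) (hφ : φ ∈ S.GammaInf U),
    (fun x => A x ⟨φ x, mem_domain φ hφ x⟩) ∈ S.GammaInf U
  adj_map_mem : ∀ (φ) (hφ : φ ∈ S.GammaInf U),
    (fun x => (A x)† ⟨φ x, mem_domain_adj φ hφ x⟩) ∈ S.GammaInf U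

/-- A smooth field of operators as a map `Γ^∞(U) → Γ^∞(U)`. -/
def IsSmoothOp.map {S : SmoothField E N H} {U : Opens N} [∀ x, CompleteSpace (H x)]
    {A : ∀ x : U, H x →ₗ.[ℂ] H x} (hA : S.IsSmoothOp U A) (φ : S.GammaInf U) : S.GammaInf U :=
  ⟨fun x => A x ⟨φ.1 x, hA.mem_domain φ.1 φ.2 x⟩, hA.map_mem φ.1 φ.2⟩

end SmoothField

end Sections

universe uE uN uH

/-- A smooth local trivialization `(U_i, F_i, T_i)_{i ∈ I}` of a smooth field of Hilbert spaces:
an open cover, Hilbert spaces `F_i` and unitary operators `T_i x : H x → F_i`, `x ∈ U_i`, such that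
`T_i (Γ^∞(U_i)) = C^∞(U_i, F_i)`. -/
structure LocalTrivialization {E : Type uE} [NormedAddCommGroup E] [NormedSpace ℝ E]
    {N : Type uN} [TopologicalSpace N] [ChartedSpace E N] [IsManifold 𝓘(ℝ, E) ∞ N]
    {H : N → Type uH} [∀ x, NormedAddCommGroup (H x)] [∀ x, InnerProductSpace ℂ (H x)]
    (S : SmoothField E N H) where
  ι : Type uN
  U : ι → Opens N
  cover : ∀ x, ∃ i, x ∈ U i
  F : ι → Type uH
  [normed : ∀ i, NormedAddCommGroup (F i)]
  [inner : ∀ i, InnerProductSpace ℂ (F i)]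
  [complete : ∀ i, CompleteSpace (F i)]
  T : ∀ (i) (x : U i), H x ≃ₗᵢ[ℂ] F i
  image_eq : ∀ i,
    (fun (φ : ∀ x : U i, H x) (x : U i) => T i x (φ x)) '' S.GammaInf (U i) =
      {f : U i → F i | ContMDiff 𝓘(ℝ, E) 𝓘(ℝ, F i) ∞ f}

end

end HilbertField

/-! If `φ` and `ψ` satisfy `∇_X φ = A(X)φ` and `∇_X ψ = A(X)ψ`, then for real `X` metric
compatibility and skewness of `A(X)` give `X h(φ, ψ) = 0`, so `h(φ, ψ)` is constant on a coordinate
ball `W` around `p` (`inner_eq_of_horizontal`). Choosing a horizontal section through each `v ∈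
H(p)` and evaluating it at `x ∈ W` therefore preserves inner products. It is onto, because a
horizontal section through `u ∈ H(x)` and the chosen one with the same value at `p` stay at distance
zero. This gives unitaries `J x : H(p) → H(x)`, and `T x = (J x)⁻¹`.

It remains to identify `Γ^∞(W)` with the smooth functions `W → H(p)`.

From sections to functions: for a smooth section `φ`, the function `⟪w, J⁻¹φ⟫ = ⟪J w, φ⟫` is smooth
for every `w`, since inner products of smooth sections are smooth (`Stable.contDiffOn_inner`). In
finitely many real variables, weak smoothness implies smoothness by the uniform boundedness
principle (`contDiffOn_of_contDiffOn_inner`).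

From functions to sections: for smooth `f`, the expected derivative of `J f` is `J(∂_i f + T_i f)`
with `T_i v = J⁻¹ ∇_i (J v)`. Each `T_i x` is skew, hence bounded, and Banach–Steinhaus bounds it
uniformly on compact sets. Over a compact set the values of `f` and `∂_i f` lie near a
finite-dimensional space, so `f` is close in `C^1` to a finite sum of smooth functions times
constant vectors, for which approximation by `Γ^∞` is available (`exists_lim_of_contMDiff`). As `J⁻¹
∇_X (J f)` is again smooth, induction puts `J f` in every `Γ^n(W)` (`mem_gammaInf_of_contMDiff`). -/

namespace HilbertField

set_option linter.unusedSectionVars false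

/-! ### Weakly smooth Hilbert space valued functions are smooth. -/

section WeakSmoothness

variable {E : Type*} [NormedAddCommGroup E] [NormedSpace ℝ E]
  {F : Type*} [NormedAddCommGroup F] [InnerProductSpace ℂ F]

theorem contDiffOn_inner_left_of_right {n : ℕ∞ω} {B : Set E} {f : E → F} {w : F}
    (hf : ContDiffOn ℝ n (fun y => ⟪w, f y⟫_ℂ) B) :
    ContDiffOn ℝ n (fun y => ⟪f y, w⟫_ℂ) B := by
  have := Complex.conjCLE.contDiff.comp_contDiffOn hf
  refine this.congr fun y _ => ?_
  simp

variable [CompleteSpace F] [FiniteDimensional ℝ E]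

/-- A weakly smooth function is Lipschitz on small balls, by the uniform boundedness principle. -/
theorem exists_lipschitz_of_contDiffOn_inner {B : Set E} (hB : IsOpen B) {f : E → F}
    (hf : ∀ w, ContDiffOn ℝ ∞ (fun y => ⟪w, f y⟫_ℂ) B) {x : E} (hx : x ∈ B) :
    ∃ C : ℝ, 0 ≤ C ∧ ∃ r > 0, Metric.ball x r ⊆ B ∧
      ∀ y ∈ Metric.ball x r, ∀ z ∈ Metric.ball x r, ‖f y - f z‖ ≤ C * ‖y - z‖ := by
  obtain ⟨r, hr, hrB⟩ := Metric.nhds_basis_closedBall.mem_iff.1 (hB.mem_nhds hx)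
  -- Uniform boundedness is applied to all difference quotients over pairs of points of the closed
  -- ball. Each pairing with a fixed `w` is `C^1`, hence Lipschitz there. On the diagonal `0⁻¹ = 0`
  -- makes the quotient vanish.
  have key : ∃ C, ∀ q : Metric.closedBall x r × Metric.closedBall x r,
      ‖((‖(q.1 : E) - q.2‖⁻¹ : ℝ) : ℂ) • innerSL ℂ (f q.1 - f q.2)‖ ≤ C := by
    apply banach_steinhaus
    intro w
    have hw := contDiffOn_inner_left_of_right (hf w)
    have hd : ∀ y ∈ Metric.closedBall x r, HasFDerivWithinAt (fun y => ⟪f y, w⟫_ℂ)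
        (fderiv ℝ (fun y => ⟪f y, w⟫_ℂ) y) (Metric.closedBall x r) y := fun y hy =>
      (((hw.contDiffAt (hB.mem_nhds (hrB hy))).differentiableAt
        (by simp)).hasFDerivAt).hasFDerivWithinAt
    have hc : ContinuousOn (fderiv ℝ (fun y => ⟪f y, w⟫_ℂ)) (Metric.closedBall x r) :=
      (hw.continuousOn_fderiv_of_isOpen hB (by simp)).mono hrB
    obtain ⟨C, hC⟩ := (isCompact_closedBall x r).exists_bound_of_continuousOn hc
    refine ⟨C, fun q => ?_⟩
    have := (convex_closedBall x r).norm_image_sub_le_of_norm_hasFDerivWithin_le hd hC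
      q.2.2 q.1.2
    rw [smul_apply, innerSL_apply_apply, norm_smul, inner_sub_left]
    have h0 : 0 ≤ C := (norm_nonneg _).trans (hC x (Metric.mem_closedBall_self hr.le))
    rw [Complex.norm_real, norm_inv, norm_norm]
    rcases eq_or_ne (‖(q.1 : E) - q.2‖) 0 with h | h
    · simpa [h] using h0
    · rw [inv_mul_le_iff₀ (by positivity)]
      linarith
  obtain ⟨C, hC⟩ := key
  refine ⟨|C|, abs_nonneg _, r, hr, Metric.ball_subset_closedBall.trans hrB, fun y hy z hz => ?_⟩
  have := hC ⟨⟨y, Metric.ball_subset_closedBall hy⟩, ⟨z, Metric.ball_subset_closedBall hz⟩⟩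
  rw [norm_smul, innerSL_apply_norm, Complex.norm_real, norm_inv, norm_norm] at this
  rcases eq_or_ne y z with rfl | h
  · simp
  · have hp : 0 < ‖y - z‖ := norm_pos_iff.2 (sub_ne_zero.2 h)
    rw [inv_mul_le_iff₀ hp] at this
    nlinarith [le_abs_self C]

/-- A weakly smooth function is differentiable, and its partial derivatives are weakly smooth. -/
theorem exists_hasFDerivAt_of_contDiffOn_inner {B : Set E} (hB : IsOpen B) {f : E → F}
    (hf : ∀ w, ContDiffOn ℝ ∞ (fun y => ⟪w, f y⟫_ℂ) B) :
    ∃ L : E → E →L[ℝ] F, (∀ y ∈ B, HasFDerivAt f (L y) y) ∧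
      ∀ v w, ContDiffOn ℝ ∞ (fun y => ⟪w, L y v⟫_ℂ) B := by
  have hw := fun w => contDiffOn_inner_left_of_right (hf w)
  have hd : ∀ w, ∀ y ∈ B, HasFDerivAt (fun y => ⟪f y, w⟫_ℂ)
      (fderiv ℝ (fun y => ⟪f y, w⟫_ℂ) y) y := fun w y hy =>
    (((hw w).contDiffAt (hB.mem_nhds hy)).differentiableAt (by simp)).hasFDerivAt
  have hex : ∀ y, ∃ L : E →L[ℝ] F, y ∈ B → ∀ v w,
      ⟪L v, w⟫_ℂ = fderiv ℝ (fun y => ⟪f y, w⟫_ℂ) y v := by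
    intro y
    by_cases hy : y ∈ B
    swap
    · exact ⟨0, fun h => absurd h hy⟩
    obtain ⟨C, hC, r, hr, hrB, hL⟩ := exists_lipschitz_of_contDiffOn_inner hB hf hy
    have hbd : ∀ v w, ‖fderiv ℝ (fun y => ⟪f y, w⟫_ℂ) y v‖ ≤ (C * ‖v‖) * ‖w‖ := by
      intro v w
      have : ‖fderiv ℝ (fun y => ⟪f y, w⟫_ℂ) y‖ ≤ C * ‖w‖ := by
        refine (hd w y hy).le_of_lip' (by positivity) ?_
        filter_upwards [Metric.ball_mem_nhds y hr] with z hz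
        rw [← inner_sub_left]
        refine (norm_inner_le_norm _ _).trans ?_
        have := hL z hz y (Metric.mem_ball_self hr)
        nlinarith [norm_nonneg w]
      refine (ContinuousLinearMap.le_of_opNorm_le _ this v).trans (le_of_eq (by ring))
    -- The pairing `⟪f y, w⟫` is linear in `w`, so its derivative along `v` is a functional of `w`,
    -- bounded thanks to the Lipschitz estimate. The Riesz vector of this functional is the partial
    -- derivative of `f` along `v`.
    let ℓ : E → F →L[ℂ] ℂ := fun v => LinearMap.mkContinuous
      { toFun := fun w => fderiv ℝ (fun y => ⟪f y, w⟫_ℂ) y v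
        map_add' := fun w w' => by
          have := ((hd w y hy).add (hd w' y hy)).fderiv
          rw [← add_apply, ← this]
          congr 2
          ext z
          simp
        map_smul' := fun c w => by
          have := ((hd w y hy).const_smul c).fderiv
          rw [RingHom.id_apply, ← smul_apply, ← this]
          congr 2
          ext z
          simp } (C * ‖v‖) (hbd v)
    let G : E → F := fun v => (InnerProductSpace.toDual ℂ F).symm (ℓ v)
    have hG : ∀ v w, ⟪G v, w⟫_ℂ = fderiv ℝ (fun y => ⟪f y, w⟫_ℂ) y v := fun v w => by
      simp only [G, InnerProductSpace.toDual_symm_apply]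
      rfl
    refine ⟨LinearMap.toContinuousLinearMap
      { toFun := G
        map_add' := fun v v' => by
          refine ext_inner_right ℂ fun w => ?_
          simp [inner_add_left, hG]
        map_smul' := fun c v => by
          refine ext_inner_right ℂ fun w => ?_
          rw [hG, map_smul, RingHom.id_apply, ← hG, RCLike.real_smul_eq_coe_smul (K := ℂ) c (G v),
            inner_smul_left]
          simp }, fun _ v w => ?_⟩
    simpa using hG v w
  choose L hL using hex
  have hsm : ∀ v w, ContDiffOn ℝ ∞ (fun y => ⟪w, L y v⟫_ℂ) B := by
    intro v w
    have h1 : ContDiffOn ℝ ∞ (fun y => fderiv ℝ (fun y => ⟪f y, w⟫_ℂ) y v) B :=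
      ((hw w).fderiv_of_isOpen hB (by simp)).clm_apply contDiffOn_const
    refine (Complex.conjCLE.contDiff.comp_contDiffOn h1).congr fun y hy => ?_
    simp [← hL y hy]
  refine ⟨L, fun x hx => ?_, hsm⟩
  -- The partial derivatives are themselves weakly smooth, so the Lipschitz estimate applies to them
  -- as well.
  have hcont : ContinuousOn L B := by
    rw [continuousOn_clm_apply]
    intro v y hy
    obtain ⟨C, hC, r, hr, hrB, hLip⟩ :=
      exists_lipschitz_of_contDiffOn_inner hB (fun w => hsm v w) hy
    have : LipschitzOnWith C.toNNReal (fun y => L y v) (Metric.ball y r) :=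
      LipschitzOnWith.of_dist_le_mul fun a ha b hb => by
        rw [dist_eq_norm, dist_eq_norm, Real.coe_toNNReal C hC]
        exact hLip a ha b hb
    exact (this.continuousOn.continuousAt (Metric.ball_mem_nhds y hr)).continuousWithinAt
  rw [hasFDerivAt_iff_isLittleO, Asymptotics.isLittleO_iff]
  intro ε hε
  have hev : ∀ᶠ y in 𝓝 x, y ∈ B ∧ ‖L y - L x‖ < ε := by
    refine (hB.eventually_mem hx).and ?_
    have := (hcont.continuousAt (hB.mem_nhds hx)).tendsto
    filter_upwards [this (Metric.ball_mem_nhds _ hε)] with y hy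
    simpa [dist_eq_norm] using hy
  obtain ⟨r, hr, hrB⟩ := Metric.nhds_basis_ball.mem_iff.1 hev
  filter_upwards [Metric.ball_mem_nhds x hr] with y hy
  -- Mean value inequality for each pairing, with a bound proportional to `‖w‖`. Taking `w` to be
  -- the remainder itself then yields the norm estimate.
  have hin : ∀ w, ‖⟪f y - f x - L x (y - x), w⟫_ℂ‖ ≤ ε * ‖y - x‖ * ‖w‖ := by
    intro w
    have := (convex_ball x r).norm_image_sub_le_of_norm_hasFDerivWithin_le'
      (f := fun y => ⟪f y, w⟫_ℂ) (φ := fderiv ℝ (fun y => ⟪f y, w⟫_ℂ) x) (C := ε * ‖w‖)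
      (fun z hz => (hd w z (hrB hz).1).hasFDerivWithinAt) (fun z hz => by
        refine ContinuousLinearMap.opNorm_le_bound _ (by positivity) fun v => ?_
        rw [sub_apply, ← hL z (hrB hz).1, ← hL x hx, ← inner_sub_left]
        refine (norm_inner_le_norm _ _).trans ?_
        rw [← sub_apply]
        have h1 := (L z - L x).le_of_opNorm_le (hrB hz).2.le v
        nlinarith [norm_nonneg w]) (Metric.mem_ball_self hr) hy
    rw [inner_sub_left, inner_sub_left, hL x hx]
    linarith
  have h1 := hin (f y - f x - L x (y - x))
  rw [inner_self_eq_norm_sq_to_K, norm_pow, RCLike.norm_ofReal, abs_norm] at h1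
  by_contra hcon
  push Not at hcon
  have hpos : 0 < ‖f y - f x - L x (y - x)‖ := lt_of_le_of_lt (by positivity) hcon
  nlinarith [mul_pos (sub_pos.2 hcon) hpos]

/-- On a finite-dimensional space, weakly smooth Hilbert space valued functions are smooth. -/
theorem contDiffOn_of_contDiffOn_inner {B : Set E} (hB : IsOpen B) {f : E → F}
    (hf : ∀ w, ContDiffOn ℝ ∞ (fun y => ⟪w, f y⟫_ℂ) B) : ContDiffOn ℝ ∞ f B := by
  rw [contDiffOn_infty]
  intro n
  induction n generalizing f with
  | zero =>
    obtain ⟨L, hL, -⟩ := exists_hasFDerivAt_of_contDiffOn_inner hB hf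
    exact contDiffOn_zero.2 fun y hy => (hL y hy).continuousAt.continuousWithinAt
  | succ n ih =>
    obtain ⟨L, hL, hw⟩ := exists_hasFDerivAt_of_contDiffOn_inner hB hf
    push_cast
    rw [contDiffOn_succ_iff_fderiv_of_isOpen hB]
    refine ⟨fun y hy => (hL y hy).differentiableAt.differentiableWithinAt, by simp, ?_⟩
    -- In finite dimension, regularity of `L` is that of its partial derivatives, to which the
    -- induction hypothesis applies.
    have : ContDiffOn ℝ n L B := contDiffOn_clm_apply.2 fun v => ih (hw v)
    exact this.congr fun y hy => (hL y hy).fderiv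

end WeakSmoothness

/-! ### Cutoffs and restriction of vector fields to open sets. -/

section ManifoldLemmas

variable {E : Type*} [NormedAddCommGroup E] [NormedSpace ℝ E]
  {M : Type*} [TopologicalSpace M] [ChartedSpace E M] [IsManifold 𝓘(ℝ, E) ∞ M]

theorem exists_cutoff [FiniteDimensional ℝ E] [T2Space M] [SecondCountableTopology M]
    {K O : Set M} (hK : IsCompact K) (hO : IsOpen O) (hKO : K ⊆ O) :
    ∃ χ : M → ℝ, ContMDiff 𝓘(ℝ, E) 𝓘(ℝ, ℝ) ∞ χ ∧ (∀ x ∈ K, ∀ᶠ y in 𝓝 x, χ y = 1) ∧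
      ∀ x ∉ O, ∀ᶠ y in 𝓝 x, χ y = 0 := by
  have : LocallyCompactSpace M := Manifold.locallyCompact_of_finiteDimensional 𝓘(ℝ, E)
  have : SigmaCompactSpace M := sigmaCompactSpace_of_locallyCompact_secondCountable
  obtain ⟨χ, h0, h1, -⟩ := exists_contMDiffMap_zero_one_nhds_of_isClosed 𝓘(ℝ, E) (n := (⊤ : ℕ∞))
    hO.isClosed_compl hK.isClosed (Set.disjoint_left.2 fun x hx hx' => hx (hKO hx'))
  exact ⟨χ, χ.contMDiff, fun x hx => eventually_nhdsSet_iff_forall.1 h1 x hx,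
    fun x hx => eventually_nhdsSet_iff_forall.1 h0 x hx⟩

theorem contMDiff_cutoff_smul {V : Type*} [NormedAddCommGroup V] [NormedSpace ℝ V] {χ : M → ℝ}
    {O : Set M} (hO : IsOpen O) (hχ : ContMDiff 𝓘(ℝ, E) 𝓘(ℝ, ℝ) ∞ χ)
    (h0 : ∀ x ∉ O, ∀ᶠ y in 𝓝 x, χ y = 0) {f : M → V}
    (hf : ContMDiffOn 𝓘(ℝ, E) 𝓘(ℝ, V) ∞ f O) :
    ContMDiff 𝓘(ℝ, E) 𝓘(ℝ, V) ∞ (fun x => χ x • f x) := by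
  intro x
  by_cases hx : x ∈ O
  · exact (hχ x).smul (hf.contMDiffAt (hO.mem_nhds hx))
  · refine (contMDiffAt_const (c := (0 : V))).congr_of_eventuallyEq ?_
    filter_upwards [h0 x hx] with y hy
    simp [hy]

/-- The derivative of a function with values in a vector space. -/
noncomputable def tdiff {V : Type*} [NormedAddCommGroup V] [NormedSpace ℝ V] (G : M → V) (x : M) :
    TangentSpace 𝓘(ℝ, E) x →L[ℝ] V :=
  mfderiv 𝓘(ℝ, E) 𝓘(ℝ, V) G x

theorem RealVect.contMDiff_apply {V : Type*} [NormedAddCommGroup V] [NormedSpace ℝ V]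
    (X : RealVect E M) {G : M → V} (hG : ContMDiff 𝓘(ℝ, E) 𝓘(ℝ, V) ∞ G) :
    ContMDiff 𝓘(ℝ, E) 𝓘(ℝ, V) ∞ (fun x => tdiff G x (X x)) := by
  have h1 := (hG.contMDiff_tangentMap (m := ∞) (by simp)).comp X.contMDiff
  exact (contMDiff_snd_tangentBundle_modelSpace V 𝓘(ℝ, V)).comp h1

/-- The inclusion has a retraction `r`, smooth near `x` (its junk value off `U` is harmless), and
the chain rule for both composites makes `dr` a two-sided inverse. -/
theorem mfderiv_subtype_val_isInvertible {U : Opens M} (x : U) :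
    (mfderiv 𝓘(ℝ, E) 𝓘(ℝ, E) (Subtype.val : U → M) x).IsInvertible := by
  classical
  let r : M → U := fun y => if h : y ∈ U then ⟨y, h⟩ else x
  have hr : ∀ y : U, r y = y := fun y => by simp [r]
  have hr1 : ContMDiffAt 𝓘(ℝ, E) 𝓘(ℝ, E) ∞ r x := by
    rw [← contMDiffAt_subtype_iff]
    simp only [hr]
    exact contMDiffAt_id
  have hr1 : MDifferentiableAt 𝓘(ℝ, E) 𝓘(ℝ, E) r (x : M) := hr1.mdifferentiableAt (by simp)
  have hv : MDifferentiableAt 𝓘(ℝ, E) 𝓘(ℝ, E) (Subtype.val : U → M) x :=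
    (contMDiff_subtype_val (n := ∞) x).mdifferentiableAt (by simp)
  have hv' : MDifferentiableAt 𝓘(ℝ, E) 𝓘(ℝ, E) (Subtype.val : U → M) (r x) := by rwa [hr]
  have e1 : (mfderiv 𝓘(ℝ, E) 𝓘(ℝ, E) r (x : M)).comp
      (mfderiv 𝓘(ℝ, E) 𝓘(ℝ, E) (Subtype.val : U → M) x) = ContinuousLinearMap.id ℝ E := by
    rw [← mfderiv_comp x hr1 hv]
    have : r ∘ (Subtype.val : U → M) = id := funext hr
    rw [this]
    exact mfderiv_id
  have e2 : (mfderiv 𝓘(ℝ, E) 𝓘(ℝ, E) (Subtype.val : U → M) x).comp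
      (mfderiv 𝓘(ℝ, E) 𝓘(ℝ, E) r (x : M)) = ContinuousLinearMap.id ℝ E := by
    have h2 := mfderiv_comp (x : M) hv' hr1
    have : (Subtype.val ∘ r : M → M) =ᶠ[𝓝 (x : M)] id := by
      filter_upwards [U.2.mem_nhds x.2] with y hy
      exact congrArg Subtype.val (hr ⟨y, hy⟩)
    rw [this.mfderiv_eq, mfderiv_id] at h2
    have h3 : mfderiv 𝓘(ℝ, E) 𝓘(ℝ, E) (Subtype.val : U → M) (r x) =
      mfderiv 𝓘(ℝ, E) 𝓘(ℝ, E) (Subtype.val : U → M) x := by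
      congr 1
      exact hr x
    rw [h3] at h2
    exact h2.symm
  exact ContinuousLinearMap.IsInvertible.of_inverse e2 e1

variable [FiniteDimensional ℝ E]

/-- The restriction of a vector field to an open set. -/
noncomputable def RealVect.restrict (X : RealVect E M) (U : Opens M) : RealVect E U :=
  ⟨VectorField.mpullback 𝓘(ℝ, E) 𝓘(ℝ, E) (Subtype.val : U → M) X,
    X.contMDiff.mpullback_vectorField contMDiff_subtype_val
      mfderiv_subtype_val_isInvertible (n := ∞) (by simp)⟩

theorem RealVect.mfderiv_restrict (X : RealVect E M) (U : Opens M) (x : U) :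
    mfderiv 𝓘(ℝ, E) 𝓘(ℝ, E) (Subtype.val : U → M) x (X.restrict U x) = X x := by
  have := mfderiv_subtype_val_isInvertible (E := E) x
  exact this.self_apply_inverse _

end ManifoldLemmas

/-- A coordinate ball of `N`: an open set `W` with coordinates `c : W → B`, together with globally
defined smooth vector fields `Y i` and functions `g i`, the restrictions of which to `W` are the
coordinate vector fields and the coordinate functions. -/
structure Patch {E : Type*} [NormedAddCommGroup E] [NormedSpace ℝ E]
    (N : Type*) [TopologicalSpace N] [ChartedSpace E N] [IsManifold 𝓘(ℝ, E) ∞ N]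
    {ι : Type*} [Fintype ι] (b : Module.Basis ι ℝ E) where
  W : Opens N
  B : Set E
  isOpen_B : IsOpen B
  convex_B : Convex ℝ B
  κ : E → W
  c : W → E
  c_mem : ∀ x, c x ∈ B
  κ_c : ∀ x, κ (c x) = x
  contMDiffOn_κ : ContMDiffOn 𝓘(ℝ, E) 𝓘(ℝ, E) ∞ (fun y => (κ y : N)) B
  contMDiff_c : ContMDiff 𝓘(ℝ, E) 𝓘(ℝ, E) ∞ c
  Y : ι → RealVect E N
  g : ι → N → ℝ
  contMDiff_g : ∀ i, ContMDiff 𝓘(ℝ, E) 𝓘(ℝ, ℝ) ∞ (g i)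
  mfderiv_κ : ∀ y ∈ B, ∀ i,
    mfderiv 𝓘(ℝ, E) 𝓘(ℝ, E) (fun y => (κ y : N)) y (b i) = Y i (κ y)
  sum_g : ∀ (x : W) (v : TangentSpace 𝓘(ℝ, E) (x : N)),
    ∑ i, tdiff (g i) (x : N) v • Y i (x : N) = v

/-! ### Coordinate balls with globally defined coordinate fields. -/

section PatchExists

variable {E : Type*} [NormedAddCommGroup E] [NormedSpace ℝ E] [FiniteDimensional ℝ E]
  {N : Type*} [TopologicalSpace N] [ChartedSpace E N] [IsManifold 𝓘(ℝ, E) ∞ N]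
  [T2Space N] [SecondCountableTopology N]
  {ι : Type*} [Fintype ι] (b : Module.Basis ι ℝ E)

/-- The coordinate frame and the coordinates of a chart at `p` are multiplied by a cutoff equal to
`1` near a closed coordinate ball. They become global without changing over the open ball `W`. -/
theorem exists_patch (p : N) (U : Opens N) (hp : p ∈ U) :
    ∃ P : Patch N b, p ∈ P.W ∧ P.W ≤ U := by
  classical
  set e := extChartAt 𝓘(ℝ, E) p with he
  have hsrc : e.source = (chartAt E p).source := extChartAt_source _ _
  have hU : e.symm ⁻¹' U ∩ e.target ∈ 𝓝 (e p) := by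
    refine inter_mem ?_ (extChartAt_target_mem_nhds p)
    refine (continuousAt_extChartAt_symm p).preimage_mem_nhds ?_
    rw [extChartAt_to_inv]
    exact U.2.mem_nhds hp
  obtain ⟨R, hR, hRB⟩ := Metric.nhds_basis_closedBall.mem_iff.1 hU
  have hbt : Metric.ball (e p) R ⊆ e.target := fun y hy =>
    (hRB (Metric.ball_subset_closedBall hy)).2
  let W : Opens N := ⟨e.source ∩ e ⁻¹' Metric.ball (e p) R,
    isOpen_extChartAt_preimage' p Metric.isOpen_ball⟩
  have hpW : p ∈ W := ⟨mem_extChartAt_source p, Metric.mem_ball_self hR⟩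
  have hWU : W ≤ U := by
    intro x hx
    have := (hRB (Metric.ball_subset_closedBall hx.2)).1
    rwa [Set.mem_preimage, e.left_inv hx.1] at this
  have hκW : ∀ y ∈ Metric.ball (e p) R, e.symm y ∈ W := fun y hy =>
    ⟨e.map_target (hbt hy), by rw [Set.mem_preimage, e.right_inv (hbt hy)]; exact hy⟩
  let κ : E → W := fun y => if h : e.symm y ∈ W then ⟨e.symm y, h⟩ else ⟨p, hpW⟩
  have hκ : ∀ y ∈ Metric.ball (e p) R, (κ y : N) = e.symm y := fun y hy => by
    simp [κ, hκW y hy]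
  -- the cutoff function
  have hKc : IsCompact (e.symm '' Metric.closedBall (e p) R) :=
    (isCompact_closedBall _ _).image_of_continuousOn
      ((continuousOn_extChartAt_symm p).mono fun y hy => (hRB hy).2)
  obtain ⟨χ, hχ, hχ1, hχ0⟩ := exists_cutoff (E := E) hKc (isOpen_extChartAt_source p)
    (by rintro _ ⟨y, hy, rfl⟩; exact e.map_target (hRB hy).2)
  have hχW : ∀ x ∈ W, ∀ᶠ y in 𝓝 x, χ y = 1 := fun x hx =>
    hχ1 x ⟨e x, Metric.ball_subset_closedBall hx.2, e.left_inv hx.1⟩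
  set t := trivializationAt E (TangentSpace 𝓘(ℝ, E) : N → Type _) p with ht
  have htb : t.baseSet = (chartAt E p).source := rfl
  have hsupp : tsupport χ ⊆ t.baseSet := by
    intro x hx
    by_contra hcon
    rw [htb, ← hsrc] at hcon
    exact (notMem_tsupport_iff_eventuallyEq.2 (hχ0 x hcon)) hx
  let Y : ι → RealVect E N := fun i => ⟨χ • t.localFrame b i,
    ContMDiffOn.smul_section_of_tsupport hχ.contMDiffOn t.open_baseSet hsupp
      (t.contMDiffOn_localFrame_baseSet ∞ b i)⟩
  have hY : ∀ i, ∀ x ∈ W, Y i x = t.symmL ℝ x (b i) := by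
    intro i x hx
    have hxb : x ∈ t.baseSet := by rw [htb, ← hsrc]; exact hx.1
    change χ x • t.localFrame b i x = _
    rw [(hχW x hx).self_of_nhds, one_smul, t.localFrame_apply_of_mem_baseSet b hxb]
    rw [t.symmL_apply hxb]
    simp [Bundle.Trivialization.basisAt]
  let L : ι → E →L[ℝ] ℝ := fun i => (b.coord i).toContinuousLinearMap
  let g : ι → N → ℝ := fun i x => χ x • L i (e x)
  have hg : ∀ i, ContMDiff 𝓘(ℝ, E) 𝓘(ℝ, ℝ) ∞ (g i) := by
    intro i
    refine contMDiff_cutoff_smul (isOpen_extChartAt_source p) hχ hχ0 ?_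
    rw [hsrc]
    exact (L i).contMDiff.comp_contMDiffOn contMDiffOn_extChartAt
  refine ⟨⟨W, Metric.ball (e p) R, Metric.isOpen_ball, convex_ball _ _, κ, fun x => e x,
    fun x => x.2.2, ?_, ?_, ?_, Y, g, hg, ?_, ?_⟩, hpW, hWU⟩
  · intro x
    exact Subtype.ext ((hκ _ x.2.2).trans (e.left_inv x.2.1))
  · exact ((contMDiffOn_extChartAt_symm p).mono hbt).congr hκ
  · intro x
    rw [contMDiffAt_subtype_iff]
    exact contMDiffAt_extChartAt' (by rw [← hsrc]; exact x.2.1)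
  · intro y hy i
    have h1 : (fun y => (κ y : N)) =ᶠ[𝓝 y] e.symm := by
      filter_upwards [Metric.isOpen_ball.mem_nhds hy] with z hz using hκ z hz
    rw [h1.mfderiv_eq, hY i _ (κ y).2, TangentBundle.symmL_trivializationAt (by
      rw [← hsrc]; exact (κ y).2.1)]
    have h2 : e (κ y) = y := by rw [hκ y hy, e.right_inv (hbt hy)]
    rw [← he, h2]
    simp
    rfl
  · intro x v
    have hxb : (x : N) ∈ t.baseSet := by rw [htb, ← hsrc]; exact x.2.1
    have hd : ∀ i, tdiff (g i) (x : N) v =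
        b.coord i (t.continuousLinearMapAt ℝ x v) := by
      intro i
      have h1 : g i =ᶠ[𝓝 (x : N)] L i ∘ e := by
        filter_upwards [hχW x x.2] with z hz
        simp [g, hz]
      rw [tdiff, h1.mfderiv_eq, TangentBundle.continuousLinearMapAt_trivializationAt (by
        rw [← hsrc]; exact x.2.1), mfderiv_comp (x : N) (L i).mdifferentiableAt
          (mdifferentiableAt_extChartAt (by rw [← hsrc]; exact x.2.1)),
          ContinuousLinearMap.mfderiv_eq]
      rfl
    simp only [hd]
    rw [Finset.sum_congr rfl fun i _ => by rw [hY i x x.2, ← map_smul], ← map_sum]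
    have : ∑ i, (b.coord i (t.continuousLinearMapAt ℝ x v)) • b i =
      t.continuousLinearMapAt ℝ x v := b.sum_repr _
    rw [this]
    exact t.symmL_continuousLinearMapAt hxb v

end PatchExists

namespace Patch

variable {E : Type*} [NormedAddCommGroup E] [NormedSpace ℝ E] [FiniteDimensional ℝ E]
  {N : Type*} [TopologicalSpace N] [ChartedSpace E N] [IsManifold 𝓘(ℝ, E) ∞ N]
  {ι : Type*} [Fintype ι] {b : Module.Basis ι ℝ E} (P : Patch N b)

theorem continuousOn_κ : ContinuousOn P.κ P.B :=
  Topology.IsInducing.subtypeVal.continuousOn_iff.2 P.contMDiffOn_κ.continuousOn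

/-- Reduces smoothness on `W` to calculus on an open subset of `E`. -/
theorem contMDiff_iff {V : Type*} [NormedAddCommGroup V] [NormedSpace ℝ V] {f : P.W → V} :
    ContMDiff 𝓘(ℝ, E) 𝓘(ℝ, V) ∞ f ↔ ContDiffOn ℝ ∞ (fun y => f (P.κ y)) P.B := by
  classical
  constructor
  · intro hf y hy
    let r : N → P.W := fun x => if h : x ∈ P.W then ⟨x, h⟩ else P.κ y
    have hr : ∀ x : P.W, r x = x := fun x => by simp [r]
    have h1 : ContMDiffAt 𝓘(ℝ, E) 𝓘(ℝ, V) ∞ (f ∘ r) (P.κ y : N) := by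
      rw [← contMDiffAt_subtype_iff]
      simp only [Function.comp_apply, hr]
      exact hf _
    have h2 := h1.comp_contMDiffWithinAt y (P.contMDiffOn_κ y hy)
    rw [contMDiffWithinAt_iff_contDiffWithinAt] at h2
    refine h2.congr (fun z _ => ?_) ?_ <;> simp [hr]
  · intro hf
    have h1 := hf.contMDiffOn.comp_contMDiff P.contMDiff_c P.c_mem
    refine h1.congr fun x => ?_
    simp [P.κ_c]

/-- The linear form with prescribed values on a basis. -/
noncomputable def grad {V : Type*} [NormedAddCommGroup V] [NormedSpace ℝ V]
    (b : Module.Basis ι ℝ E) (q : ι → V) : E →L[ℝ] V :=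
  ∑ i, (b.coord i).toContinuousLinearMap.smulRight (q i)

theorem grad_apply {V : Type*} [NormedAddCommGroup V] [NormedSpace ℝ V]
    (q : ι → V) (i : ι) : grad b q (b i) = q i := by
  classical
  simp only [grad, sum_apply, ContinuousLinearMap.smulRight_apply]
  simp [Finsupp.single_apply]

theorem hasFDerivAt_comp_κ {V : Type*} [NormedAddCommGroup V] [NormedSpace ℝ V] {h : N → V}
    (hh : ContMDiff 𝓘(ℝ, E) 𝓘(ℝ, V) ∞ h) {y : E} (hy : y ∈ P.B) :
    HasFDerivAt (fun y => h (P.κ y))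
      (grad b fun i => tdiff h (P.κ y : N) (P.Y i (P.κ y))) y := by
  have h1 : MDifferentiableAt 𝓘(ℝ, E) 𝓘(ℝ, V) h (P.κ y : N) :=
    (hh _).mdifferentiableAt (by simp)
  have h2 : MDifferentiableAt 𝓘(ℝ, E) 𝓘(ℝ, E) (fun y => (P.κ y : N)) y :=
    (P.contMDiffOn_κ.contMDiffAt (P.isOpen_B.mem_nhds hy)).mdifferentiableAt (by simp)
  have h3 := mfderiv_comp y h1 h2
  have h4 : HasFDerivAt (fun y => h (P.κ y)) (fderiv ℝ (h ∘ fun y => (P.κ y : N)) y) y :=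
    (h1.comp y h2).differentiableAt.hasFDerivAt
  convert h4 using 1
  refine ContinuousLinearMap.coe_injective (b.ext fun j => ?_)
  have h5 : fderiv ℝ (h ∘ fun y => (P.κ y : N)) y (b j) =
      tdiff h (P.κ y : N) (P.Y j (P.κ y)) := by
    rw [← mfderiv_eq_fderiv, h3, ← P.mfderiv_κ y hy]
    rfl
  exact (grad_apply _ j).trans h5.symm

end Patch

/-! ### Locally uniform limits of sections. -/

section LocalUniformLimits

variable {N : Type*} [TopologicalSpace N] {H : N → Type*} [∀ x, NormedAddCommGroup (H x)]

theorem locUnifLim_iff {U : Opens N} {s : ℕ → ∀ x : U, H x} {φ : ∀ x : U, H x} :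
    LocUnifLim s φ ↔
      ∀ ε > 0, ∀ x : U, ∃ t ∈ 𝓝 x, ∀ᶠ k in atTop, ∀ y ∈ t, ‖s k y - φ y‖ < ε := by
  simp [LocUnifLim, Metric.tendstoLocallyUniformly_iff]

theorem LocUnifLim.tendsto {U : Opens N} {s : ℕ → ∀ x : U, H x} {φ : ∀ x : U, H x}
    (h : LocUnifLim s φ) (x : U) : Tendsto (fun k => s k x) atTop (𝓝 (φ x)) := by
  rw [tendsto_iff_norm_sub_tendsto_zero]
  exact TendstoLocallyUniformlyOn.tendsto_at (tendstoLocallyUniformlyOn_univ.2 h)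
    (Set.mem_univ x)

theorem LocUnifLim.restrict {U V : Opens N} (hUV : U ≤ V) {s : ℕ → ∀ x : V, H x}
    {φ : ∀ x : V, H x} (h : LocUnifLim s φ) :
    LocUnifLim (fun k (x : U) => s k ⟨x, hUV x.2⟩) (fun x : U => φ ⟨x, hUV x.2⟩) :=
  TendstoLocallyUniformly.comp h (fun x : U => (⟨x, hUV x.2⟩ : V)) (by fun_prop)

variable [∀ x, InnerProductSpace ℂ (H x)]

theorem LocUnifLim.sum_smul {U : Opens N} {ι : Type*} [Fintype ι] {s : ι → ℕ → ∀ x : U, H x}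
    {φ : ι → ∀ x : U, H x} (h : ∀ i, LocUnifLim (s i) (φ i)) {c : ι → U → ℂ}
    (hc : ∀ i, Continuous (c i)) :
    LocUnifLim (fun k x => ∑ i, c i x • s i k x) (fun x => ∑ i, c i x • φ i x) := by
  rw [locUnifLim_iff]
  intro ε hε x
  set C : ι → ℝ := fun i => ‖c i x‖ + 1 with hC
  have hCp : ∀ i, 0 < C i := fun i => by positivity
  set δ : ℝ := ε / (1 + ∑ i, C i) with hδ
  have hsum : 0 ≤ ∑ i, C i := Finset.sum_nonneg fun i _ => (hCp i).le
  have hδp : 0 < δ := by positivity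
  have h1 : ∀ i, ∃ t ∈ 𝓝 x, ∀ᶠ k in atTop, ∀ y ∈ t, ‖s i k y - φ i y‖ < δ := fun i =>
    locUnifLim_iff.1 (h i) δ hδp x
  choose t ht hk using h1
  have h2 : ∀ i, ∀ᶠ y in 𝓝 x, ‖c i y‖ < C i := fun i =>
    (hc i).norm.continuousAt.eventually_lt continuousAt_const (by simp [hC])
  refine ⟨(⋂ i, t i) ∩ {y | ∀ i, ‖c i y‖ < C i},
    inter_mem (Filter.iInter_mem.2 ht) (eventually_all.2 h2), ?_⟩
  filter_upwards [eventually_all.2 hk] with k hk y hy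
  rw [← Finset.sum_sub_distrib]
  calc ‖∑ i, (c i y • s i k y - c i y • φ i y)‖
      ≤ ∑ i, C i * δ := by
        refine norm_sum_le_of_le _ fun i _ => ?_
        rw [← smul_sub, norm_smul]
        exact mul_le_mul (hy.2 i).le (hk i y (Set.mem_iInter.1 hy.1 i)).le (norm_nonneg _)
          (hCp i).le
    _ = (∑ i, C i) * δ := by rw [Finset.sum_mul]
    _ < (1 + ∑ i, C i) * δ := by nlinarith
    _ = ε := by rw [hδ]; field_simp

end LocalUniformLimits

/-! ### Pointwise dependence of the connection on the vector field. -/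

section Tensoriality

variable {E : Type*} [NormedAddCommGroup E] [NormedSpace ℝ E] [FiniteDimensional ℝ E]
  {N : Type*} [TopologicalSpace N] [ChartedSpace E N] [IsManifold 𝓘(ℝ, E) ∞ N]
  {H : N → Type*} [∀ x, NormedAddCommGroup (H x)] [∀ x, InnerProductSpace ℂ (H x)]

theorem RealVect.sum_apply {M : Type*} [TopologicalSpace M] [ChartedSpace E M]
    [IsManifold 𝓘(ℝ, E) ∞ M] {ι : Type*} (s : Finset ι) (X : ι → RealVect E M) (x : M) :
    (∑ i ∈ s, X i) x = ∑ i ∈ s, X i x := by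
  have := congrFun (map_sum (ContMDiffSection.coeAddHom 𝓘(ℝ, E) E ∞
    (TangentSpace 𝓘(ℝ, E) : M → Type _)) X s) x
  rw [Finset.sum_apply] at this
  exact this

/-- A real vector field as a complex one. -/
noncomputable def Vect.ofReal {M : Type*} [TopologicalSpace M] [ChartedSpace E M]
    [IsManifold 𝓘(ℝ, E) ∞ M] (X : RealVect E M) : Vect E M := ⟨X, 0⟩

theorem Vect.conj_ofReal {M : Type*} [TopologicalSpace M] [ChartedSpace E M]
    [IsManifold 𝓘(ℝ, E) ∞ M] (X : RealVect E M) : (Vect.ofReal X).conj = Vect.ofReal X := by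
  ext1
  · rfl
  · exact neg_zero

/-- The derivative of a real function along a complex vector field. -/
noncomputable def Vect.rderiv {M : Type*} [TopologicalSpace M] [ChartedSpace E M]
    [IsManifold 𝓘(ℝ, E) ∞ M] (X : Vect E M) (g : M → ℝ) (x : M) : ℂ :=
  (tdiff g x (X.re x) : ℂ) + Complex.I * (tdiff g x (X.im x) : ℂ)

theorem Vect.contMDiff_rderiv {M : Type*} [TopologicalSpace M] [ChartedSpace E M]
    [IsManifold 𝓘(ℝ, E) ∞ M] (X : Vect E M) {g : M → ℝ}
    (hg : ContMDiff 𝓘(ℝ, E) 𝓘(ℝ, ℝ) ∞ g) : ContMDiff 𝓘(ℝ, E) 𝓘(ℝ, ℂ) ∞ (X.rderiv g) := by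
  have h : ∀ Y : RealVect E M, ContMDiff 𝓘(ℝ, E) 𝓘(ℝ, ℂ) ∞ (fun x => (tdiff g x (Y x) : ℂ)) :=
    fun Y => Complex.ofRealCLM.contDiff.contMDiff.comp (Y.contMDiff_apply hg)
  have h2 : ContDiff ℝ ∞ (fun z : ℂ => Complex.I * z) := contDiff_const.mul contDiff_id
  exact (h X.re).add (h2.contMDiff.comp (h X.im))

namespace SmoothField

variable (S : SmoothField E N H)

/-- `X ↦ ∇_X φ (x)` as an additive map. -/
noncomputable def nablaHom (φ : S.Γ) (x : N) : RealVect E N × RealVect E N →+ H x :=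
  AddMonoidHom.mk' (fun X => (S.nabla ⟨X.1, X.2⟩ φ).1 x) fun X Y =>
    congrFun (S.nabla_add ⟨X.1, X.2⟩ ⟨Y.1, Y.2⟩ φ) x

variable {ι : Type*} [Fintype ι] {b : Module.Basis ι ℝ E} (P : Patch N b)

/-- The covariant derivative in the direction of a coordinate vector field. -/
noncomputable def nb (i : ι) (φ : S.Γ) : S.Γ := S.nabla (Vect.ofReal (P.Y i)) φ

variable [T2Space N] [SecondCountableTopology N]

/-- With a cutoff `χ` supported in `W` and equal to `1` at `x`, the identity `χZ = ∑ χ Z(g_i) Y_i`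
holds on all of `N`, so linearity of `∇` over smooth functions applies. -/
theorem nabla_eq_sum (Z : Vect E N) (φ : S.Γ) (x : P.W) :
    (S.nabla Z φ).1 x = ∑ i, Z.rderiv (P.g i) x • (S.nb P i φ).1 x := by
  obtain ⟨χ, hχ, hχ1, hχ0⟩ := exists_cutoff (E := E) (isCompact_singleton (x := (x : N)))
    P.W.2 (Set.singleton_subset_iff.2 x.2)
  have hx1 : χ x = 1 := (hχ1 x rfl).self_of_nhds
  have hofReal : ContMDiff 𝓘(ℝ, E) 𝓘(ℝ, ℂ) ∞ (fun x => (χ x : ℂ)) :=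
    Complex.ofRealCLM.contDiff.contMDiff.comp hχ
  let a : SmoothFun E N := ⟨fun x => (χ x : ℂ), hofReal⟩
  let c : ι → SmoothFun E N := fun i => ⟨fun x => χ x • Z.rderiv (P.g i) x,
    hχ.smul (Z.contMDiff_rderiv (P.contMDiff_g i))⟩
  -- Written for pairs of real fields, whose additive group makes finite sums available; off `W`
  -- both sides vanish with `χ`.
  have key : ((a • Z).re, (a • Z).im) = ∑ i,
      ((c i • Vect.ofReal (P.Y i)).re, (c i • Vect.ofReal (P.Y i)).im) := by
    refine Prod.ext ?_ ?_
    · rw [Prod.fst_sum]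
      refine ContMDiffSection.ext fun z => ?_
      rw [RealVect.sum_apply]
      have h1 : (a • Z).re z = χ z • Z.re z := by
        change (χ z : ℂ).re • Z.re z - (χ z : ℂ).im • Z.im z = _
        simp
      have h2 : ∀ i, (c i • Vect.ofReal (P.Y i)).re z =
          χ z • (tdiff (P.g i) z (Z.re z) • P.Y i z) := by
        intro i
        change (χ z • Z.rderiv (P.g i) z).re • P.Y i z - (χ z • Z.rderiv (P.g i) z).im •
          (0 : TangentSpace 𝓘(ℝ, E) z) = _
        simp [Vect.rderiv, smul_smul]
      rw [h1]
      simp only [h2]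
      rw [← Finset.smul_sum]
      by_cases hz : z ∈ P.W
      · rw [P.sum_g ⟨z, hz⟩]
      · rw [(hχ0 z hz).self_of_nhds, zero_smul, zero_smul]
    · rw [Prod.snd_sum]
      refine ContMDiffSection.ext fun z => ?_
      rw [RealVect.sum_apply]
      have h1 : (a • Z).im z = χ z • Z.im z := by
        change (χ z : ℂ).re • Z.im z + (χ z : ℂ).im • Z.re z = _
        simp
      have h2 : ∀ i, (c i • Vect.ofReal (P.Y i)).im z =
          χ z • (tdiff (P.g i) z (Z.im z) • P.Y i z) := by
        intro i
        change (χ z • Z.rderiv (P.g i) z).re • (0 : TangentSpace 𝓘(ℝ, E) z) +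
          (χ z • Z.rderiv (P.g i) z).im • P.Y i z = _
        simp [Vect.rderiv, smul_smul]
      rw [h1]
      simp only [h2]
      rw [← Finset.smul_sum]
      by_cases hz : z ∈ P.W
      · rw [P.sum_g ⟨z, hz⟩]
      · rw [(hχ0 z hz).self_of_nhds, zero_smul, zero_smul]
  have h3 := congrArg (S.nablaHom φ x) key
  rw [map_sum] at h3
  have h4 : S.nablaHom φ x ((a • Z).re, (a • Z).im) = (S.nabla Z φ).1 x := by
    change (S.nabla (a • Z) φ).1 x = _
    rw [S.nabla_smul]
    change (χ x : ℂ) • _ = _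
    rw [hx1, Complex.ofReal_one, one_smul]
  rw [← h4, h3]
  refine Finset.sum_congr rfl fun i _ => ?_
  change (S.nabla (c i • Vect.ofReal (P.Y i)) φ).1 x = _
  rw [S.nabla_smul]
  change (χ x • Z.rderiv (P.g i) x) • _ = _
  rw [hx1, one_smul]
  rfl

variable {U : Opens N} (hU : P.W ≤ U)

theorem rderiv_eq_of_agreeAt {X : Vect E U} {Y : Vect E N} {x : U} (h : X.AgreeAt Y x) {g : N → ℝ}
    (hg : ContMDiff 𝓘(ℝ, E) 𝓘(ℝ, ℝ) ∞ g) :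
    Y.rderiv g x = X.rderiv (fun z : U => g z) x := by
  have hd : ∀ v, tdiff (fun z : U => g z) x v =
      tdiff g (x : N) (mfderiv 𝓘(ℝ, E) 𝓘(ℝ, E) (Subtype.val : U → N) x v) := by
    intro v
    have h1 := mfderiv_comp x ((hg x).mdifferentiableAt (by simp))
      ((contMDiff_subtype_val (I := 𝓘(ℝ, E)) (n := ∞) x).mdifferentiableAt (by simp))
    exact congrArg (fun L => L v) h1
  rw [Vect.rderiv, Vect.rderiv, h.1, h.2, hd, hd]

include hU in
-- Makes `nablaRes` independent of the chosen extension: the coordinate expansion at `x` involves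
-- only the value of the field there.
theorem nablaRes_eq_nabla {X : Vect E U} {Y : Vect E N} (x : P.W)
    (h : X.AgreeAt Y ⟨x, hU x.2⟩) (φ : S.Γ) :
    S.nablaRes U X φ ⟨x, hU x.2⟩ = (S.nabla Y φ).1 x := by
  have hex : ∃ Y : Vect E N, X.AgreeAt Y ⟨x, hU x.2⟩ := ⟨Y, h⟩
  rw [nablaRes, dif_pos hex]
  change (S.nabla hex.choose φ).1 x = _
  rw [S.nabla_eq_sum P, S.nabla_eq_sum P]
  refine Finset.sum_congr rfl fun i _ => ?_
  congr 1
  exact (rderiv_eq_of_agreeAt hex.choose_spec (P.contMDiff_g i)).trans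
    (rderiv_eq_of_agreeAt h (P.contMDiff_g i)).symm

theorem nablaRes_restrict (i : ι) (φ : S.Γ) (x : P.W) :
    S.nablaRes U (Vect.ofReal ((P.Y i).restrict U)) φ ⟨x, hU x.2⟩ = (S.nb P i φ).1 x := by
  refine S.nablaRes_eq_nabla P hU x (Y := Vect.ofReal (P.Y i)) ⟨?_, ?_⟩ φ
  · exact ((P.Y i).mfderiv_restrict U _).symm
  · exact (map_zero _).symm

theorem nablaRes_eq_sum (X : Vect E P.W) (φ : S.Γ) (x : P.W) :
    S.nablaRes P.W X φ x = ∑ i, X.rderiv (fun z : P.W => P.g i z) x • (S.nb P i φ).1 x := by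
  let ρ : TangentSpace 𝓘(ℝ, E) x → TangentSpace 𝓘(ℝ, E) (x : N) := fun v =>
    mfderiv 𝓘(ℝ, E) 𝓘(ℝ, E) (Subtype.val : P.W → N) x v
  -- A combination of the `Y i` with constant coefficients, which need agree with `X` at the single
  -- point `x` only.
  let Y : Vect E N := ⟨∑ i, tdiff (P.g i) (x : N) (ρ (X.re x)) • P.Y i,
    ∑ i, tdiff (P.g i) (x : N) (ρ (X.im x)) • P.Y i⟩
  have hY : X.AgreeAt Y x := by
    constructor
    · refine (RealVect.sum_apply _ _ _).trans ?_
      exact P.sum_g x (ρ (X.re x))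
    · refine (RealVect.sum_apply _ _ _).trans ?_
      exact P.sum_g x (ρ (X.im x))
  have h1 := S.nablaRes_eq_nabla P le_rfl x hY φ
  refine h1.trans ?_
  rw [S.nabla_eq_sum P]
  refine Finset.sum_congr rfl fun i _ => ?_
  congr 1
  exact rderiv_eq_of_agreeAt hY (P.contMDiff_g i)

/-- There is a sequence in `Γ^∞` converging to `φ` locally uniformly on the coordinate ball, the
derivatives of which along the coordinate vector fields converge to `D`. -/
def Lim (φ : ∀ x : P.W, H x) (D : ι → ∀ x : P.W, H x) : Prop :=
  ∃ s : ℕ → S.Γ, LocUnifLim (fun k (x : P.W) => (s k).1 x) φ ∧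
    ∀ i, LocUnifLim (fun k (x : P.W) => (S.nb P i (s k)).1 x) (D i)

variable {S P}

theorem IsDeriv.lim {φ : ∀ x : U, H x} {D : Vect E U → ∀ x : U, H x} (h : S.IsDeriv U φ D) :
    S.Lim P (fun x => φ ⟨x, hU x.2⟩)
      (fun i x => D (Vect.ofReal ((P.Y i).restrict U)) ⟨x, hU x.2⟩) := by
  obtain ⟨s, hs, hD⟩ := h
  refine ⟨s, hs.restrict hU, fun i => ?_⟩
  have := (hD (Vect.ofReal ((P.Y i).restrict U))).restrict hU
  simpa only [S.nablaRes_restrict P hU] using this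

/-- Fields on `W` are smooth combinations of the coordinate fields, and locally uniform convergence
survives continuous coefficients. Hence convergence in finitely many directions suffices. -/
theorem Lim.isDeriv {φ : ∀ x : P.W, H x} {D : ι → ∀ x : P.W, H x} (h : S.Lim P φ D) :
    S.IsDeriv P.W φ (fun X x => ∑ i, X.rderiv (fun z : P.W => P.g i z) x • D i x) := by
  obtain ⟨s, hs, hD⟩ := h
  refine ⟨s, hs, fun X => ?_⟩
  have := LocUnifLim.sum_smul hD (c := fun i => X.rderiv (fun z : P.W => P.g i z)) fun i =>
    (X.contMDiff_rderiv ((P.contMDiff_g i).comp contMDiff_subtype_val)).continuous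
  simpa only [← S.nablaRes_eq_sum P] using this

theorem IsDeriv.eq_sum {φ : ∀ x : P.W, H x} {D : Vect E P.W → ∀ x : P.W, H x}
    (h : S.IsDeriv P.W φ D) (X : Vect E P.W) (x : P.W) :
    D X x = ∑ i, X.rderiv (fun z : P.W => P.g i z) x •
      D (Vect.ofReal ((P.Y i).restrict P.W)) x := by
  obtain ⟨s, hs, hD⟩ := h
  refine tendsto_nhds_unique ((hD X).tendsto x) ?_
  simp only [S.nablaRes_eq_sum P X]
  refine tendsto_finsetSum _ fun i _ => Tendsto.const_smul ?_ _
  simp only [← S.nablaRes_restrict P le_rfl i]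
  exact (hD _).tendsto x

end SmoothField

end Tensoriality

/-! ### Smoothness of inner products of smooth sections. -/

section InnerLimits

variable {E : Type*} [NormedAddCommGroup E] [NormedSpace ℝ E] [FiniteDimensional ℝ E]
  {N : Type*} [TopologicalSpace N] [ChartedSpace E N] [IsManifold 𝓘(ℝ, E) ∞ N]
  {H : N → Type*} [∀ x, NormedAddCommGroup (H x)] [∀ x, InnerProductSpace ℂ (H x)]

theorem tendstoLocallyUniformlyOn_finset_sum {α V ι κ : Type*} [TopologicalSpace α]
    [NormedAddCommGroup V] {l : Filter κ} {s : Set α} (t : Finset ι) {F : ι → κ → α → V}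
    {f : ι → α → V} (h : ∀ i, TendstoLocallyUniformlyOn (F i) (f i) l s) :
    TendstoLocallyUniformlyOn (fun k y => ∑ i ∈ t, F i k y) (fun y => ∑ i ∈ t, f i y) l s := by
  classical
  induction t using Finset.induction_on with
  | empty =>
    simp only [Finset.sum_empty]
    exact fun u hu x _ => ⟨Set.univ, univ_mem,
      Eventually.of_forall fun _ _ _ => refl_mem_uniformity hu⟩
  | insert a t ha ih =>
    simp only [Finset.sum_insert ha]
    exact (h a).add ih

theorem LocUnifLim.inner {U : Opens N} {s t : ℕ → ∀ x : U, H x} {φ ψ : ∀ x : U, H x}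
    (hs : LocUnifLim s φ) (ht : LocUnifLim t ψ)
    (hφ : ∀ x, ∃ C, ∀ᶠ y in 𝓝 x, ‖φ y‖ ≤ C) (hψ : ∀ x, ∃ C, ∀ᶠ y in 𝓝 x, ‖ψ y‖ ≤ C) :
    TendstoLocallyUniformly (fun k x => ⟪t k x, s k x⟫_ℂ) (fun x => ⟪ψ x, φ x⟫_ℂ) atTop := by
  rw [Metric.tendstoLocallyUniformly_iff]
  intro ε hε x
  obtain ⟨C, hC⟩ := hφ x
  obtain ⟨C', hC'⟩ := hψ x
  -- `δ ≤ 1` absorbs the quadratic error term into a linear one.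
  set δ : ℝ := min 1 (ε / (2 + |C| + |C'|)) with hδ
  have hδp : 0 < δ := lt_min one_pos (by positivity)
  have hδε : δ * (2 + |C| + |C'|) ≤ ε := by
    rw [← le_div_iff₀ (by positivity)]
    exact min_le_right _ _
  obtain ⟨n1, hn1, h1⟩ := locUnifLim_iff.1 hs δ hδp x
  obtain ⟨n2, hn2, h2⟩ := locUnifLim_iff.1 ht δ hδp x
  refine ⟨(n1 ∩ n2) ∩ ({y | ‖φ y‖ ≤ C} ∩ {y | ‖ψ y‖ ≤ C'}),
    inter_mem (inter_mem hn1 hn2) (inter_mem hC hC'), ?_⟩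
  filter_upwards [h1, h2] with k h1 h2 y hy
  have a1 := h1 y hy.1.1
  have a2 := h2 y hy.1.2
  have a3 : ‖φ y‖ ≤ |C| := hy.2.1.trans (le_abs_self C)
  have a4 : ‖ψ y‖ ≤ |C'| := hy.2.2.trans (le_abs_self C')
  rw [dist_comm, dist_eq_norm]
  have e : ⟪t k y, s k y⟫_ℂ - ⟪ψ y, φ y⟫_ℂ = ⟪t k y - ψ y, s k y - φ y⟫_ℂ +
      ⟪t k y - ψ y, φ y⟫_ℂ + ⟪ψ y, s k y - φ y⟫_ℂ := by
    simp only [inner_sub_left, inner_sub_right]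
    ring
  rw [e]
  have b1 : ‖⟪t k y - ψ y, s k y - φ y⟫_ℂ‖ ≤ δ * 1 :=
    (norm_inner_le_norm _ _).trans (mul_le_mul a2.le (a1.le.trans (min_le_left _ _))
      (norm_nonneg _) hδp.le)
  have b2 : ‖⟪t k y - ψ y, φ y⟫_ℂ‖ ≤ δ * |C| :=
    (norm_inner_le_norm _ _).trans (mul_le_mul a2.le a3 (norm_nonneg _) hδp.le)
  have b3 : ‖⟪ψ y, s k y - φ y⟫_ℂ‖ ≤ |C'| * δ :=
    (norm_inner_le_norm _ _).trans (mul_le_mul a4 a1.le (norm_nonneg _) (abs_nonneg _))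
  have b4 := norm_add₃_le (a := ⟪t k y - ψ y, s k y - φ y⟫_ℂ) (b := ⟪t k y - ψ y, φ y⟫_ℂ)
    (c := ⟪ψ y, s k y - φ y⟫_ℂ)
  nlinarith

namespace SmoothField

variable (S : SmoothField E N H)

theorem continuous_norm (φ : S.Γ) : Continuous fun x => ‖φ.1 x‖ := by
  have h := (S.smooth_inner φ.1 φ.2 φ.1 φ.2).continuous
  have : (fun x => ‖φ.1 x‖) = fun x => Real.sqrt (‖⟪φ.1 x, φ.1 x⟫_ℂ‖) := by
    ext x
    rw [inner_self_eq_norm_sq_to_K, norm_pow, RCLike.norm_ofReal, abs_norm,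
      Real.sqrt_sq (norm_nonneg _)]
  rw [this]
  exact h.norm.sqrt

/-- Elements of `Γ^∞` have continuous norm because `h(φ, φ)` is smooth, and locally the limit is
within `1` of one of them. -/
theorem locally_bounded {U : Opens N} {s : ℕ → S.Γ} {φ : ∀ x : U, H x}
    (h : LocUnifLim (fun k (x : U) => (s k).1 x) φ) (x : U) :
    ∃ C, ∀ᶠ y in 𝓝 x, ‖φ y‖ ≤ C := by
  obtain ⟨t, ht, hk⟩ := locUnifLim_iff.1 h 1 one_pos x
  obtain ⟨k, hk⟩ := hk.exists
  refine ⟨(‖(s k).1 x‖ + 1) + 1, ?_⟩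
  have hc : Continuous fun y : U => ‖(s k).1 y‖ :=
    (S.continuous_norm (s k)).comp continuous_subtype_val
  have h2 : ∀ᶠ y : U in 𝓝 x, ‖(s k).1 y‖ < ‖(s k).1 x‖ + 1 :=
    hc.continuousAt.eventually_lt continuousAt_const (by simp)
  filter_upwards [ht, h2] with y hy h2
  have h3 := hk y hy
  have h4 : ‖φ y‖ ≤ ‖(s k).1 y‖ + ‖(s k).1 y - φ y‖ := by
    rw [← norm_neg (_ - _), neg_sub]
    simpa using norm_add_le ((s k).1 (y : N)) (φ y - (s k).1 y)
  linarith

variable {S} {ι : Type*} [Fintype ι] {b : Module.Basis ι ℝ E} {P : Patch N b}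

theorem tdiff_inner (φ ψ : S.Γ) (i : ι) (x : N) :
    tdiff (fun x => ⟪ψ.1 x, φ.1 x⟫_ℂ) x (P.Y i x) =
      ⟪ψ.1 x, (S.nb P i φ).1 x⟫_ℂ + ⟪(S.nb P i ψ).1 x, φ.1 x⟫_ℂ := by
  have h := S.deriv_inner (Vect.ofReal (P.Y i)) φ ψ x
  rw [Vect.conj_ofReal] at h
  rw [nb, nb, ← h]
  change _ = tdiff _ x (P.Y i x) + Complex.I * tdiff _ x (0 : TangentSpace 𝓘(ℝ, E) x)
  rw [map_zero, mul_zero, add_zero]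

/-- Metric compatibility passes to the limit: the inner products of the approximants converge, and
their derivatives converge locally uniformly. -/
theorem Lim.hasFDerivAt_inner {φ ψ : ∀ x : P.W, H x} {D D' : ι → ∀ x : P.W, H x}
    (h : S.Lim P φ D) (h' : S.Lim P ψ D') {y : E} (hy : y ∈ P.B) :
    HasFDerivAt (fun y => ⟪ψ (P.κ y), φ (P.κ y)⟫_ℂ)
      (Patch.grad b fun i => ⟪ψ (P.κ y), D i (P.κ y)⟫_ℂ + ⟪D' i (P.κ y), φ (P.κ y)⟫_ℂ) y := by
  obtain ⟨s, hs, hD⟩ := h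
  obtain ⟨t, ht, hD'⟩ := h'
  have conv : ∀ {F : ℕ → P.W → ℂ} {f : P.W → ℂ}, TendstoLocallyUniformly F f atTop →
      TendstoLocallyUniformlyOn (fun k y => F k (P.κ y)) (fun y => f (P.κ y)) atTop P.B :=
    fun hF => TendstoLocallyUniformlyOn.comp (tendstoLocallyUniformlyOn_univ.2 hF) P.κ
      (fun _ _ => Set.mem_univ _) P.continuousOn_κ
  refine hasFDerivAt_of_tendstoLocallyUniformlyOn
    (f := fun k y => ⟪(t k).1 (P.κ y), (s k).1 (P.κ y)⟫_ℂ)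
    (f' := fun k y => Patch.grad b fun i => ⟪(t k).1 (P.κ y), (S.nb P i (s k)).1 (P.κ y)⟫_ℂ +
      ⟪(S.nb P i (t k)).1 (P.κ y), (s k).1 (P.κ y)⟫_ℂ)
    (g' := fun y => Patch.grad b fun i => ⟪ψ (P.κ y), D i (P.κ y)⟫_ℂ +
      ⟪D' i (P.κ y), φ (P.κ y)⟫_ℂ) (l := atTop) P.isOpen_B ?_ ?_ ?_ hy
  · refine tendstoLocallyUniformlyOn_finset_sum Finset.univ fun i => ?_
    refine (ContinuousLinearMap.smulRightL ℝ E ℂ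
      (b.coord i).toContinuousLinearMap).uniformContinuous.comp_tendstoLocallyUniformlyOn ?_
    refine (conv (LocUnifLim.inner (hD i) ht ?_ ?_)).add (conv (LocUnifLim.inner hs (hD' i) ?_ ?_))
    · exact S.locally_bounded (hD i)
    · exact S.locally_bounded ht
    · exact S.locally_bounded hs
    · exact S.locally_bounded (hD' i)
  · intro k z hz
    have := P.hasFDerivAt_comp_κ (S.smooth_inner (s k).1 (s k).2 (t k).1 (t k).2) hz
    simp only [tdiff_inner] at this
    exact this
  · intro z hz
    exact (conv (LocUnifLim.inner hs ht (S.locally_bounded hs)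
      (S.locally_bounded ht))).tendsto_at hz

variable (S P) in
/-- A set of sections over the coordinate ball which admit derivatives in the same set. -/
def Stable (G : Set (∀ x : P.W, H x)) : Prop :=
  ∀ φ ∈ G, ∃ D, (∀ i, D i ∈ G) ∧ S.Lim P φ D

/-- The derivative is a sum of inner products of the same kind, so the induction runs over all pairs
at once. Two classes are allowed because sections over `W` get paired with restrictions of sections
over a larger `U`. -/
theorem Stable.contDiffOn_inner {G G' : Set (∀ x : P.W, H x)} (hG : S.Stable P G)
    (hG' : S.Stable P G') {φ ψ : ∀ x : P.W, H x} (hφ : φ ∈ G) (hψ : ψ ∈ G') :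
    ContDiffOn ℝ ∞ (fun y => ⟪ψ (P.κ y), φ (P.κ y)⟫_ℂ) P.B := by
  rw [contDiffOn_infty]
  intro n
  induction n generalizing φ ψ with
  | zero =>
    obtain ⟨D, -, hD⟩ := hG φ hφ
    obtain ⟨D', -, hD'⟩ := hG' ψ hψ
    exact contDiffOn_zero.2 fun y hy =>
      (hD.hasFDerivAt_inner hD' hy).continuousAt.continuousWithinAt
  | succ n ih =>
    obtain ⟨D, hDG, hD⟩ := hG φ hφ
    obtain ⟨D', hDG', hD'⟩ := hG' ψ hψ
    push_cast
    rw [contDiffOn_succ_iff_fderiv_of_isOpen P.isOpen_B]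
    refine ⟨fun y hy => (hD.hasFDerivAt_inner hD' hy).differentiableAt.differentiableWithinAt,
      by simp, ?_⟩
    refine ContDiffOn.congr ?_ fun y hy => (hD.hasFDerivAt_inner hD' hy).fderiv
    refine ContDiffOn.sum fun i _ => ?_
    exact contDiffOn_const.smulRight ((ih (hDG i) hψ).add (ih hφ (hDG' i)))

/-- The choice made in `nablaExt` does not depend on `X`, so one sequence serves all directions. -/
theorem isDeriv_nablaExt {U : Opens N} {φ : ∀ x : U, H x} (h : φ ∈ S.Gamma U 1) :
    S.IsDeriv U φ fun X => S.nablaExt U X φ := by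
  have h2 : ∃ D, S.IsDeriv U φ D := h.2
  have h3 : (fun X => S.nablaExt U X φ) = h2.choose := by
    ext1 X
    rw [nablaExt, dif_pos h2]
  rw [h3]
  exact h2.choose_spec

theorem nablaExt_mem_gammaInf {U : Opens N} {φ : ∀ x : U, H x} (h : φ ∈ S.GammaInf U)
    (X : Vect E U) : S.nablaExt U X φ ∈ S.GammaInf U := by
  have h1 : ∀ n, S.nablaExt U X φ ∈ S.Gamma U (n + 1) := fun n => (Set.mem_iInter.1 h (n + 2)).2 X
  refine Set.mem_iInter.2 fun n => ?_
  cases n with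
  | zero => exact (h1 0).1
  | succ n => exact h1 n

variable [T2Space N] [SecondCountableTopology N]

theorem stable_gammaInf {U : Opens N} (hU : P.W ≤ U) :
    S.Stable P ((fun φ (x : P.W) => φ ⟨x, hU x.2⟩) '' S.GammaInf U) := by
  rintro _ ⟨φ, hφ, rfl⟩
  exact ⟨_, fun i => ⟨_, nablaExt_mem_gammaInf hφ (Vect.ofReal ((P.Y i).restrict U)), rfl⟩,
    (isDeriv_nablaExt (Set.mem_iInter.1 hφ 1)).lim hU⟩

end SmoothField

end InnerLimits

/-! ### Hilbert space lemmas. -/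

section HilbertLemmas

variable {F : Type*} [NormedAddCommGroup F] [InnerProductSpace ℂ F]

/-- Compact subsets of a Hilbert space are almost invariant under a finite rank projection. -/
theorem exists_finite_rank_approx {K : Set F} (hK : IsCompact K) {ε : ℝ} (hε : 0 < ε) :
    ∃ (n : ℕ) (u : Fin n → F), ∀ g ∈ K, ‖∑ k, ⟪u k, g⟫_ℂ • u k - g‖ < ε := by
  obtain ⟨t, -, htf, ht⟩ := hK.finite_cover_balls hε
  -- The orthogonal projection onto the span of a finite `ε`-net is at least as close to `g` as the
  -- nearest net point.
  let G : Submodule ℂ F := Submodule.span ℂ t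
  have : FiniteDimensional ℂ G := FiniteDimensional.span_of_finite ℂ htf
  let u := stdOrthonormalBasis ℂ G
  refine ⟨_, fun k => (u k : F), fun g hg => ?_⟩
  have h1 : ∑ k, ⟪(u k : F), g⟫_ℂ • (u k : F) = G.starProjection g := by
    rw [u.starProjection_eq_sum_rankOne]
    simp
  obtain ⟨z, hz, hgz⟩ := Set.mem_iUnion₂.1 (ht hg)
  rw [h1, ← norm_neg, neg_sub, G.starProjection_minimal]
  refine (ciInf_le ⟨0, by rintro _ ⟨x, rfl⟩; positivity⟩
    (⟨z, Submodule.subset_span hz⟩ : G)).trans_lt ?_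
  simpa [dist_eq_norm] using hgz

/-- A surjective map which preserves inner products is a unitary operator. -/
theorem exists_linearIsometryEquiv {G : Type*} [NormedAddCommGroup G] [InnerProductSpace ℂ G]
    (f : F → G) (hf : ∀ v w, ⟪f v, f w⟫_ℂ = ⟪v, w⟫_ℂ) (hs : Function.Surjective f) :
    ∃ J : F ≃ₗᵢ[ℂ] G, ∀ v, J v = f v := by
  -- By surjectivity, equalities in the target can be tested against vectors `f z`; linearity of `f`
  -- is thus a consequence.
  have hinj : ∀ {a b : G}, (∀ z, ⟪f z, a⟫_ℂ = ⟪f z, b⟫_ℂ) → a = b := fun h =>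
    ext_inner_left ℂ fun w => by obtain ⟨z, rfl⟩ := hs w; exact h z
  let L : F →ₗᵢ[ℂ] G :=
    { toFun := f
      map_add' := fun v w => hinj fun z => by simp only [inner_add_right, hf]
      map_smul' := fun c v => hinj fun z => by simp only [inner_smul_right, hf, RingHom.id_apply]
      norm_map' := fun v => by
        have h := congrArg Norm.norm (hf v v)
        rw [inner_self_eq_norm_sq_to_K, inner_self_eq_norm_sq_to_K, norm_pow, norm_pow,
          RCLike.norm_ofReal, RCLike.norm_ofReal, abs_norm, abs_norm] at h
        exact (sq_eq_sq₀ (norm_nonneg _) (norm_nonneg _)).1 h }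
  exact ⟨LinearIsometryEquiv.ofSurjective L hs, fun v => rfl⟩

/-- A skew-symmetric map on a Hilbert space is a bounded operator. -/
theorem exists_clm_of_skew [CompleteSpace F] (B : F → F)
    (h : ∀ v w, ⟪B w, v⟫_ℂ + ⟪w, B v⟫_ℂ = 0) : ∃ T : F →L[ℂ] F, ∀ v, T v = B v := by
  have h' : ∀ v w, ⟪w, B v⟫_ℂ = -⟪B w, v⟫_ℂ := fun v w => eq_neg_of_add_eq_zero_right (h v w)
  let L : F →ₗ[ℂ] F :=
    { toFun := B
      map_add' := fun v w => ext_inner_left ℂ fun z => by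
        simp only [inner_add_right, h']
        ring
      map_smul' := fun c v => ext_inner_left ℂ fun z => by
        simp only [inner_smul_right, h', RingHom.id_apply]
        ring }
  -- `iL` is symmetric and everywhere defined, hence continuous by Hellinger–Toeplitz.
  have hsym : (Complex.I • L).IsSymmetric := fun v w => by
    change ⟪Complex.I • B v, w⟫_ℂ = ⟪v, Complex.I • B w⟫_ℂ
    rw [inner_smul_left, inner_smul_right, h']
    simp
  have hc := hsym.continuous.const_smul (-Complex.I)
  refine ⟨⟨L, ?_⟩, fun v => rfl⟩
  refine hc.congr fun v => ?_
  change -Complex.I • Complex.I • L v = L v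
  rw [smul_smul]
  simp

end HilbertLemmas

/-! ### Coordinate derivatives and approximation on compact sets. -/

namespace Patch

variable {E : Type*} [NormedAddCommGroup E] [NormedSpace ℝ E] [FiniteDimensional ℝ E]
  {N : Type*} [TopologicalSpace N] [ChartedSpace E N] [IsManifold 𝓘(ℝ, E) ∞ N]
  {ι : Type*} [Fintype ι] {b : Module.Basis ι ℝ E} (P : Patch N b)
  {V : Type*} [NormedAddCommGroup V] [NormedSpace ℝ V]

/-- The coordinate derivatives of a function on the coordinate ball. -/
noncomputable def pd (f : P.W → V) (i : ι) (x : P.W) : V :=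
  fderiv ℝ (fun y => f (P.κ y)) (P.c x) (b i)

variable {P}

theorem contMDiff_pd {f : P.W → V} (hf : ContMDiff 𝓘(ℝ, E) 𝓘(ℝ, V) ∞ f) (i : ι) :
    ContMDiff 𝓘(ℝ, E) 𝓘(ℝ, V) ∞ (P.pd f i) := by
  have h1 : ContDiffOn ℝ ∞ (fun y => fderiv ℝ (fun y => f (P.κ y)) y (b i)) P.B :=
    ((P.contMDiff_iff.1 hf).fderiv_of_isOpen P.isOpen_B (by simp)).clm_apply contDiffOn_const
  exact h1.contMDiffOn.comp_contMDiff P.contMDiff_c P.c_mem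

theorem hasFDerivAt_comp_κ' {f : P.W → V} (hf : ContMDiff 𝓘(ℝ, E) 𝓘(ℝ, V) ∞ f) (x : P.W) :
    HasFDerivAt (fun y => f (P.κ y)) (fderiv ℝ (fun y => f (P.κ y)) (P.c x)) (P.c x) :=
  (((P.contMDiff_iff.1 hf).contDiffAt (P.isOpen_B.mem_nhds (P.c_mem x))).differentiableAt
    (by simp)).hasFDerivAt

theorem pd_inner {F : Type*} [NormedAddCommGroup F] [InnerProductSpace ℂ F] {f : P.W → F}
    (hf : ContMDiff 𝓘(ℝ, E) 𝓘(ℝ, F) ∞ f) (w : F) (i : ι) (x : P.W) :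
    P.pd (fun x => ⟪w, f x⟫_ℂ) i x = ⟪w, P.pd f i x⟫_ℂ := by
  have h := ((innerSL ℂ w).restrictScalars ℝ).hasFDerivAt.comp (P.c x)
    (P.hasFDerivAt_comp_κ' hf x)
  exact congrArg (fun L => L (b i)) h.fderiv

theorem contMDiff_inner {F : Type*} [NormedAddCommGroup F] [InnerProductSpace ℂ F] {f g : P.W → F}
    (hf : ContMDiff 𝓘(ℝ, E) 𝓘(ℝ, F) ∞ f) (hg : ContMDiff 𝓘(ℝ, E) 𝓘(ℝ, F) ∞ g) :
    ContMDiff 𝓘(ℝ, E) 𝓘(ℝ, ℂ) ∞ (fun x => ⟪f x, g x⟫_ℂ) :=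
  P.contMDiff_iff.2 ((P.contMDiff_iff.1 hf).inner ℂ (P.contMDiff_iff.1 hg))

end Patch

namespace SmoothField

variable {E : Type*} [NormedAddCommGroup E] [NormedSpace ℝ E] [FiniteDimensional ℝ E]
  {N : Type*} [TopologicalSpace N] [ChartedSpace E N] [IsManifold 𝓘(ℝ, E) ∞ N]
  {H : N → Type*} [∀ x, NormedAddCommGroup (H x)] [∀ x, InnerProductSpace ℂ (H x)]
  (S : SmoothField E N H) {ι : Type*} [Fintype ι] {b : Module.Basis ι ℝ E} (P : Patch N b)

/-- Additivity of `∇` in the section is not an axiom; it follows from metric compatibility, tested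
against the dense set of values of `Γ^∞`. -/
theorem nb_add (i : ι) (φ ψ : S.Γ) (x : N) :
    (S.nb P i ⟨φ.1 + ψ.1, S.add_mem _ φ.2 _ ψ.2⟩).1 x =
      (S.nb P i φ).1 x + (S.nb P i ψ).1 x := by
  refine (S.dense x).eq_of_inner_right ℂ ?_
  rintro _ ⟨χ, hχ, rfl⟩
  have h1 := tdiff_inner (P := P) ⟨φ.1 + ψ.1, S.add_mem _ φ.2 _ ψ.2⟩ ⟨χ, hχ⟩ i x
  have h2 := tdiff_inner (P := P) φ ⟨χ, hχ⟩ i x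
  have h3 := tdiff_inner (P := P) ψ ⟨χ, hχ⟩ i x
  have hd : ∀ φ : S.Γ, MDifferentiableAt 𝓘(ℝ, E) 𝓘(ℝ, ℂ) (fun x => ⟪χ x, φ.1 x⟫_ℂ) x := fun φ =>
    (S.smooth_inner φ.1 φ.2 χ hχ x).mdifferentiableAt (by simp)
  have h4 : (fun x => ⟪χ x, (φ.1 + ψ.1) x⟫_ℂ) =
      (fun x => ⟪χ x, φ.1 x⟫_ℂ) + fun x => ⟪χ x, ψ.1 x⟫_ℂ := by
    ext z
    exact inner_add_right _ _ _
  have h5 : tdiff (fun x => ⟪χ x, (φ.1 + ψ.1) x⟫_ℂ) x (P.Y i x) =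
      tdiff (fun x => ⟪χ x, φ.1 x⟫_ℂ) x (P.Y i x) +
      tdiff (fun x => ⟪χ x, ψ.1 x⟫_ℂ) x (P.Y i x) := by
    rw [h4]
    exact congrArg (fun L => L (P.Y i x)) (mfderiv_add (hd φ) (hd ψ))
  rw [h5, h2, h3] at h1
  have h6 : ⟪(S.nb P i ⟨χ, hχ⟩).1 x, (φ.1 + ψ.1) x⟫_ℂ = ⟪(S.nb P i ⟨χ, hχ⟩).1 x, φ.1 x⟫_ℂ +
    ⟪(S.nb P i ⟨χ, hχ⟩).1 x, ψ.1 x⟫_ℂ := inner_add_right _ _ _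
  rw [h6] at h1
  rw [inner_add_right]
  linear_combination -h1

theorem nb_smul (i : ι) (a : SmoothFun E N) (φ : S.Γ) (x : N) :
    (S.nb P i ⟨fun x => a x • φ.1 x, S.smul_mem a φ.1 φ.2⟩).1 x =
      tdiff a x (P.Y i x) • φ.1 x + a x • (S.nb P i φ).1 x := by
  rw [nb, S.leibniz]
  have : (Vect.ofReal (P.Y i)).deriv a x = tdiff a x (P.Y i x) := by
    change tdiff a x (P.Y i x) + Complex.I * tdiff a x (0 : TangentSpace 𝓘(ℝ, E) x) = _
    rw [map_zero, mul_zero, add_zero]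
  change (Vect.ofReal (P.Y i)).deriv a x • _ + _ = _
  rw [this]
  rfl

/-- Sections which are approximated on `K`, together with given derivatives, by elements
of `Γ^∞`. -/
def App (K : Set P.W) (φ : ∀ x : P.W, H x) (D : ι → ∀ x : P.W, H x) : Prop :=
  ∀ ε > 0, ∃ t : S.Γ, ∀ x ∈ K, ‖t.1 x - φ x‖ < ε ∧ ∀ i, ‖(S.nb P i t).1 x - D i x‖ < ε

variable {S P}

theorem App.add {K : Set P.W} {φ φ' : ∀ x : P.W, H x} {D D' : ι → ∀ x : P.W, H x}
    (h : S.App P K φ D) (h' : S.App P K φ' D') :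
    S.App P K (fun x => φ x + φ' x) (fun i x => D i x + D' i x) := by
  intro ε hε
  obtain ⟨t, ht⟩ := h (ε / 2) (by positivity)
  obtain ⟨t', ht'⟩ := h' (ε / 2) (by positivity)
  refine ⟨⟨t.1 + t'.1, S.add_mem _ t.2 _ t'.2⟩, fun x hx => ⟨?_, fun i => ?_⟩⟩
  · change ‖t.1 x + t'.1 x - (φ x + φ' x)‖ < ε
    rw [add_sub_add_comm]
    exact (norm_add_le _ _).trans_lt (by linarith [(ht x hx).1, (ht' x hx).1])
  · rw [nb_add, add_sub_add_comm]
    exact (norm_add_le _ _).trans_lt (by linarith [(ht x hx).2 i, (ht' x hx).2 i])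

theorem uniform_of_locUnifLim {U : Opens N} {s : ℕ → ∀ x : U, H x} {φ : ∀ x : U, H x}
    (h : LocUnifLim s φ) {K : Set U} (hK : IsCompact K) {ε : ℝ} (hε : 0 < ε) :
    ∀ᶠ k in atTop, ∀ x ∈ K, ‖s k x - φ x‖ < ε := by
  have h1 := (tendstoLocallyUniformlyOn_iff_tendstoUniformlyOn_of_compact hK).1
    (TendstoLocallyUniformly.tendstoLocallyUniformlyOn h)
  filter_upwards [Metric.tendstoUniformlyOn_iff.1 h1 ε hε] with k hk x hx
  simpa using hk x hx

variable [T2Space N] [SecondCountableTopology N]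

/-- The function `a` lives on `W` only. Cut off near `K` it becomes an element `A` of `C^∞(N)` equal
to `a` near `K`, and the Leibniz rule for `A` times the approximants has the required limit. -/
theorem Lim.app_smul {K : Set P.W} (hK : IsCompact K) {φ : ∀ x : P.W, H x}
    {D : ι → ∀ x : P.W, H x} (h : S.Lim P φ D) {a : P.W → ℂ}
    (ha : ContMDiff 𝓘(ℝ, E) 𝓘(ℝ, ℂ) ∞ a) :
    S.App P K (fun x => a x • φ x) (fun i x => P.pd a i x • φ x + a x • D i x) := by
  classical
  intro ε hε
  obtain ⟨s, hs, hD⟩ := h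
  have hK' : IsCompact (Subtype.val '' K : Set N) := hK.image continuous_subtype_val
  obtain ⟨χ, hχ, hχ1, hχ0⟩ := exists_cutoff (E := E) hK' P.W.2
    (by rintro _ ⟨x, -, rfl⟩; exact x.2)
  let a' : N → ℂ := fun x => if h : x ∈ P.W then a ⟨x, h⟩ else 0
  have ha' : ∀ x : P.W, a' x = a x := fun x => by simp [a']
  let A : SmoothFun E N := ⟨fun x => χ x • a' x, contMDiff_cutoff_smul P.W.2 hχ hχ0 fun x hx => by
    refine ContMDiffAt.contMDiffWithinAt ?_
    refine (contMDiffAt_subtype_iff (x := (⟨x, hx⟩ : P.W))).1 ?_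
    simp only [ha']
    exact ha _⟩
  have hA : ∀ x ∈ K, A x = a x := fun x hx => by
    change χ x • a' x = _
    rw [(hχ1 x ⟨x, hx, rfl⟩).self_of_nhds, one_smul, ha']
  have hAd : ∀ x ∈ K, ∀ i, tdiff A (x : N) (P.Y i x) = P.pd a i x := by
    intro x hx i
    have h1 := P.hasFDerivAt_comp_κ A.contMDiff (P.c_mem x)
    have h2 : (fun y => A (P.κ y)) =ᶠ[𝓝 (P.c x)] fun y => a (P.κ y) := by
      have hc : ContinuousAt (fun y => (P.κ y : N)) (P.c x) :=
        P.contMDiffOn_κ.continuousOn.continuousAt (P.isOpen_B.mem_nhds (P.c_mem x))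
      have h3 : ∀ᶠ y in 𝓝 (P.κ (P.c x) : N), χ y = 1 := by
        rw [P.κ_c]
        exact hχ1 x ⟨x, hx, rfl⟩
      filter_upwards [hc.eventually h3] with y hy
      change χ (P.κ y) • a' (P.κ y) = _
      rw [hy, one_smul, ha']
    rw [Patch.pd, ← h2.fderiv_eq, h1.fderiv]
    have h5 : ∀ z, z = x → tdiff A (x : N) (P.Y i x) = tdiff A (z : N) (P.Y i z) := by
      rintro _ rfl
      rfl
    rw [Patch.grad_apply]
    exact h5 _ (P.κ_c x)
  have hbd : ∀ f : P.W → ℂ, Continuous f → ∃ C > 0, ∀ x ∈ K, ‖f x‖ ≤ C := fun f hf => by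
    obtain ⟨C, hC⟩ := hK.exists_bound_of_continuousOn hf.continuousOn
    exact ⟨|C| + 1, by positivity, fun x hx => (hC x hx).trans (by linarith [le_abs_self C])⟩
  obtain ⟨C, hC, hCa⟩ := hbd a ha.continuous
  choose C' hC' hCa' using fun i => hbd (P.pd a i) (P.contMDiff_pd ha i).continuous
  have e0 := uniform_of_locUnifLim hs hK (ε := ε / (2 * C)) (by positivity)
  have e1 : ∀ᶠ k in atTop, ∀ i, ∀ x ∈ K, ‖(s k).1 (x : N) - φ x‖ < ε / (2 * C' i) :=
    eventually_all.2 fun i =>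
      uniform_of_locUnifLim hs hK (by have := hC' i; positivity)
  have e2 : ∀ᶠ k in atTop, ∀ i, ∀ x ∈ K, ‖(S.nb P i (s k)).1 (x : N) - D i x‖ < ε / (2 * C) :=
    eventually_all.2 fun i => uniform_of_locUnifLim (hD i) hK (by positivity)
  obtain ⟨k, k0, k1, k2⟩ := (e0.and (e1.and e2)).exists
  have hmul : ∀ (x : P.W) (c : ℂ) (v : H x) (M : ℝ), 0 < M → ‖c‖ ≤ M → ‖v‖ < ε / (2 * M) →
      ‖c • v‖ < ε / 2 := by
    intro x c v M hM hc hv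
    rw [norm_smul]
    calc ‖c‖ * ‖v‖ ≤ M * ‖v‖ := by gcongr
      _ < M * (ε / (2 * M)) := by gcongr
      _ = ε / 2 := by field_simp
  refine ⟨⟨fun x => A x • (s k).1 x, S.smul_mem A _ (s k).2⟩, fun x hx => ⟨?_, fun i => ?_⟩⟩
  · change ‖A x • (s k).1 x - a x • φ x‖ < ε
    rw [hA x hx, ← smul_sub]
    exact (hmul x _ _ C hC (hCa x hx) (k0 x hx)).trans (by linarith)
  · rw [nb_smul, hA x hx, hAd x hx, add_sub_add_comm, ← smul_sub, ← smul_sub]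
    refine (norm_add_le _ _).trans_lt ?_
    linarith [hmul x _ _ _ (hC' i) (hCa' i x hx) (k1 i x hx),
      hmul x _ _ C hC (hCa x hx) (k2 i x hx)]

/-- Diagonal choice: along a compact exhaustion, the `m`-th approximant has error below `1/(m+1)` on
the `m`-th compact set. -/
theorem lim_of_app {φ : ∀ x : P.W, H x} {D : ι → ∀ x : P.W, H x}
    (h : ∀ K : Set P.W, IsCompact K → S.App P K φ D) : S.Lim P φ D := by
  have : LocallyCompactSpace N := Manifold.locallyCompact_of_finiteDimensional 𝓘(ℝ, E)
  have : LocallyCompactSpace P.W := P.W.2.locallyCompactSpace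
  have : SigmaCompactSpace P.W := sigmaCompactSpace_of_locallyCompact_secondCountable
  let K := CompactExhaustion.choice P.W
  choose s hs using fun m : ℕ => h (K m) (K.isCompact m) (1 / ((m : ℝ) + 1)) (by positivity)
  have hsmall : ∀ ε > 0, ∀ᶠ m : ℕ in atTop, 1 / ((m : ℝ) + 1) < ε := fun ε hε =>
    (tendsto_one_div_add_atTop_nhds_zero_nat (𝕜 := ℝ)).eventually_lt_const hε
  refine ⟨s, ?_, fun i => ?_⟩ <;>
  · rw [locUnifLim_iff]
    intro ε hε x
    obtain ⟨n, hn⟩ := K.exists_mem_nhds x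
    refine ⟨K n, hn, ?_⟩
    filter_upwards [hsmall ε hε, eventually_ge_atTop n] with m hm hmn y hy
    have h1 := hs m y (K.subset hmn hy)
    first
      | exact h1.1.trans hm
      | exact (h1.2 i).trans hm

end SmoothField

/-! ### Sections in a flat frame `J`. -/

namespace SmoothField

variable {E : Type*} [NormedAddCommGroup E] [NormedSpace ℝ E] [FiniteDimensional ℝ E]
  {N : Type*} [TopologicalSpace N] [ChartedSpace E N] [IsManifold 𝓘(ℝ, E) ∞ N]
  {H : N → Type*} [∀ x, NormedAddCommGroup (H x)] [∀ x, InnerProductSpace ℂ (H x)]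
  {S : SmoothField E N H} {ι : Type*} [Fintype ι] {b : Module.Basis ι ℝ E} {P : Patch N b}

section FlatFrame

variable {F : Type*} [NormedAddCommGroup F] [InnerProductSpace ℂ F] [CompleteSpace F]
  {J : ∀ x : P.W, F ≃ₗᵢ[ℂ] H x} {G : Set (∀ x : P.W, H x)} (hG : S.Stable P G)
  (hJ : ∀ v, (fun x => J x v) ∈ G)

theorem inner_symm_right (x : P.W) (w : F) (u : H x) :
    ⟪w, (J x).symm u⟫_ℂ = ⟪J x w, u⟫_ℂ := by
  rw [← (J x).inner_map_map, (J x).apply_symm_apply]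

include hG hJ

theorem Stable.contMDiff_symm {G' : Set (∀ x : P.W, H x)} (hG' : S.Stable P G')
    {φ : ∀ x : P.W, H x} (hφ : φ ∈ G') :
    ContMDiff 𝓘(ℝ, E) 𝓘(ℝ, F) ∞ (fun x => (J x).symm (φ x)) := by
  rw [P.contMDiff_iff]
  refine contDiffOn_of_contDiffOn_inner P.isOpen_B fun w => ?_
  simp only [inner_symm_right]
  exact hG'.contDiffOn_inner hG hφ (hJ w)

/-- The derivative of a section which is smooth in the flat frame is smooth in the flat frame. -/
theorem Lim.contMDiff_symm {f : P.W → F} (hf : ContMDiff 𝓘(ℝ, E) 𝓘(ℝ, F) ∞ f)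
    {D : ι → ∀ x : P.W, H x} (hD : S.Lim P (fun x => J x (f x)) D) (i : ι) :
    ContMDiff 𝓘(ℝ, E) 𝓘(ℝ, F) ∞ (fun x => (J x).symm (D i x)) := by
  rw [P.contMDiff_iff]
  refine contDiffOn_of_contDiffOn_inner P.isOpen_B fun w => ?_
  obtain ⟨Dw, hDwG, hDw⟩ := hG _ (hJ w)
  have h1 : ContMDiff 𝓘(ℝ, E) 𝓘(ℝ, F) ∞ (fun x => (J x).symm (Dw i x)) :=
    hG.contMDiff_symm hJ hG (hDwG i)
  have h2 : ContDiffOn ℝ ∞ (fun y => ⟪w, f (P.κ y)⟫_ℂ) P.B :=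
    contDiffOn_const.inner ℂ (P.contMDiff_iff.1 hf)
  have h3 : ContDiffOn ℝ ∞ (fun y => fderiv ℝ (fun y => ⟪w, f (P.κ y)⟫_ℂ) y (b i)) P.B :=
    (h2.fderiv_of_isOpen P.isOpen_B (by simp)).clm_apply contDiffOn_const
  -- `⟪w, J⁻¹D_i⟫ = ∂_i⟪w, f⟫ - ⟪J⁻¹∇_i(J w), f⟫`. This holds for any admissible `D`, so uniqueness
  -- of derivatives is never needed.
  refine (h3.sub ((P.contMDiff_iff.1 h1).inner ℂ (P.contMDiff_iff.1 hf))).congr fun y hy => ?_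
  have h4 := hD.hasFDerivAt_inner hDw hy
  simp only [LinearIsometryEquiv.inner_map_map] at h4
  rw [h4.fderiv, Patch.grad_apply, inner_symm_right, eq_sub_iff_add_eq]
  congr 1
  rw [← (J (P.κ y)).inner_map_map, (J (P.κ y)).apply_symm_apply]

variable [T2Space N] [SecondCountableTopology N]

/-- A section which is smooth in the flat frame is differentiable. -/
theorem exists_lim_of_contMDiff {f : P.W → F} (hf : ContMDiff 𝓘(ℝ, E) 𝓘(ℝ, F) ∞ f) :
    ∃ D, S.Lim P (fun x => J x (f x)) D := by
  choose D hDG hD using fun v => hG _ (hJ v)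
  have hBs : ∀ v i, ContMDiff 𝓘(ℝ, E) 𝓘(ℝ, F) ∞ (fun x => (J x).symm (D v i x)) := fun v i =>
    hG.contMDiff_symm hJ hG (hDG v i)
  -- Differentiate the constant function `⟪J w, J v⟫ = ⟪w, v⟫`.
  have hskew : ∀ (i : ι) (x : P.W) (v w : F),
      ⟪(J x).symm (D w i x), v⟫_ℂ + ⟪w, (J x).symm (D v i x)⟫_ℂ = 0 := by
    intro i x v w
    obtain ⟨y, hy, rfl⟩ : ∃ y ∈ P.B, P.κ y = x := ⟨_, P.c_mem x, P.κ_c x⟩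
    have h1 := (hD v).hasFDerivAt_inner (hD w) hy
    simp only [LinearIsometryEquiv.inner_map_map] at h1
    have h2 := h1.unique (hasFDerivAt_const ⟪w, v⟫_ℂ y)
    have h3 := congrArg (fun L => L (b i)) h2
    simp only [Patch.grad_apply] at h3
    rw [inner_symm_right, ← (J (P.κ y)).inner_map_map, (J (P.κ y)).apply_symm_apply, add_comm]
    exact h3
  -- `T i x` is the connection form in the frame `J`. The derivatives `D v` were chosen separately
  -- for each `v`; linearity in `v` comes from skewness.
  choose T hT using fun (i : ι) (x : P.W) =>
    exists_clm_of_skew (fun v => (J x).symm (D v i x)) (hskew i x)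
  refine ⟨fun i x => J x (P.pd f i x + T i x (f x)), lim_of_app fun K hK => ?_⟩
  have hC : ∀ i, ∃ C, ∀ x : K, ‖T i x‖ ≤ C := fun i => banach_steinhaus fun v => by
    obtain ⟨C, hC⟩ := hK.exists_bound_of_continuousOn (hBs v i).continuous.continuousOn
    exact ⟨C, fun x => by rw [hT]; exact hC x x.2⟩
  choose C hC using hC
  -- One finite family `u` serves `f` and all `∂_i f`. As the `u k` are constant, the derivative of
  -- the projected function is the projection of the derivative.
  have key : ∀ ε > 0, ∃ (n : ℕ) (u : Fin n → F), ∀ x ∈ K,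
      ‖∑ k, ⟪u k, f x⟫_ℂ • u k - f x‖ < ε ∧
      ∀ i, ‖∑ k, ⟪u k, P.pd f i x⟫_ℂ • u k - P.pd f i x‖ < ε := by
    intro ε hε
    have hcomp : IsCompact (f '' K ∪ ⋃ i, P.pd f i '' K) :=
      (hK.image hf.continuous).union
        (isCompact_iUnion fun i => hK.image (P.contMDiff_pd hf i).continuous)
    obtain ⟨n, u, hu⟩ := exists_finite_rank_approx hcomp hε
    refine ⟨n, u, fun x hx => ⟨hu _ (Or.inl ⟨x, hx, rfl⟩), fun i => hu _ (Or.inr ?_)⟩⟩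
    exact Set.mem_iUnion.2 ⟨i, x, hx, rfl⟩
  have happ : ∀ (n : ℕ) (u : Fin n → F), S.App P K
      (fun x => J x (∑ k, ⟪u k, f x⟫_ℂ • u k))
      (fun i x => J x (∑ k, (⟪u k, P.pd f i x⟫_ℂ • u k + ⟪u k, f x⟫_ℂ • T i x (u k)))) := by
    intro n u
    have hone : ∀ (w : F) {a : P.W → ℂ} (ha : ContMDiff 𝓘(ℝ, E) 𝓘(ℝ, ℂ) ∞ a), S.App P K
        (fun x => J x (a x • w)) (fun i x => J x (P.pd a i x • w + a x • T i x w)) := by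
      intro w a ha
      have := (hD w).app_smul hK ha
      simp only [map_add, map_smul, hT, LinearIsometryEquiv.apply_symm_apply]
      exact this
    induction n with
    | zero =>
      -- The zero section is approximated by multiples `0 • s k`.
      have := hone 0 (a := fun _ => 0) contMDiff_const
      simpa using this
    | succ n ih =>
      have h1 := hone (u 0) (P.contMDiff_inner (contMDiff_const (c := u 0)) hf)
      have h2 := h1.add (ih fun k => u k.succ)
      simp only [P.pd_inner hf, ← map_add] at h2
      simpa only [Fin.sum_univ_succ] using h2
  intro ε hε
  -- `M` strictly exceeds every `1 + |C i|`, the factor by which the projection error enters the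
  -- derivative; the other `ε / 2` is the approximation error.
  set M : ℝ := 2 + ∑ i, |C i| with hM
  have hMp : 2 ≤ M := le_add_of_nonneg_right (Finset.sum_nonneg fun i _ => abs_nonneg _)
  set δ : ℝ := ε / (2 * M) with hδ
  have hδp : 0 < δ := by positivity
  have hδM : δ * M = ε / 2 := by rw [hδ]; field_simp
  obtain ⟨n, u, hu⟩ := key δ hδp
  obtain ⟨t, ht⟩ := happ n u (ε / 2) (by positivity)
  refine ⟨t, fun x hx => ⟨?_, fun i => ?_⟩⟩
  · have h1 := (ht x hx).1
    have h2 : ‖J x (∑ k, ⟪u k, f x⟫_ℂ • u k) - J x (f x)‖ < δ := by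
      rw [← map_sub, LinearIsometryEquiv.norm_map]
      exact (hu x hx).1
    have h3 := norm_sub_le_norm_sub_add_norm_sub (t.1 (x : N)) (J x (∑ k, ⟪u k, f x⟫_ℂ • u k))
      (J x (f x))
    nlinarith
  · have h1 := (ht x hx).2 i
    have h2 : ‖J x (∑ k, (⟪u k, P.pd f i x⟫_ℂ • u k + ⟪u k, f x⟫_ℂ • T i x (u k))) -
        J x (P.pd f i x + T i x (f x))‖ ≤ δ * (1 + |C i|) := by
      rw [← map_sub, LinearIsometryEquiv.norm_map, Finset.sum_add_distrib]
      have e : ∑ k, ⟪u k, f x⟫_ℂ • T i x (u k) = T i x (∑ k, ⟪u k, f x⟫_ℂ • u k) := by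
        simp only [map_sum, map_smul]
      rw [e, add_sub_add_comm, ← map_sub]
      have e1 := ((hu x hx).2 i).le
      have e2 : ‖T i x (∑ k, ⟪u k, f x⟫_ℂ • u k - f x)‖ ≤ |C i| * δ :=
        (T i x).le_of_opNorm_le_of_le ((hC i ⟨x, hx⟩).trans (le_abs_self _)) (hu x hx).1.le
      exact (norm_add_le _ _).trans (by linarith)
    have h3 := norm_sub_le_norm_sub_add_norm_sub ((S.nb P i t).1 (x : N))
      (J x (∑ k, (⟪u k, P.pd f i x⟫_ℂ • u k + ⟪u k, f x⟫_ℂ • T i x (u k))))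
      (J x (P.pd f i x + T i x (f x)))
    have h4 : |C i| ≤ ∑ i, |C i| :=
      Finset.single_le_sum (f := fun i => |C i|) (fun i _ => abs_nonneg _) (Finset.mem_univ i)
    nlinarith

/-- `∇_X (J f)` is a smooth combination of coordinate derivatives, each of which is `J` of a smooth
function. The class of all `J f` is thus closed under `∇_X`, and induction on `n` applies. -/
theorem mem_gammaInf_of_contMDiff {f : P.W → F} (hf : ContMDiff 𝓘(ℝ, E) 𝓘(ℝ, F) ∞ f) :
    (fun x => J x (f x)) ∈ S.GammaInf P.W := by
  have h0 : ∀ {f : P.W → F}, ContMDiff 𝓘(ℝ, E) 𝓘(ℝ, F) ∞ f →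
      (fun x => J x (f x)) ∈ S.Gamma P.W 1 := fun hf => by
    obtain ⟨D, hD⟩ := exists_lim_of_contMDiff hG hJ hf
    obtain ⟨s, hs, -⟩ := id hD
    exact ⟨⟨s, hs⟩, _, hD.isDeriv⟩
  have h1 : ∀ (n : ℕ) {f : P.W → F}, ContMDiff 𝓘(ℝ, E) 𝓘(ℝ, F) ∞ f →
      (fun x => J x (f x)) ∈ S.Gamma P.W (n + 1) := by
    intro n
    induction n with
    | zero => exact h0
    | succ n ih =>
      intro f hf
      refine ⟨ih hf, fun X => ?_⟩
      have h2 := isDeriv_nablaExt (h0 hf)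
      have h3 := Lim.contMDiff_symm hG hJ hf (h2.lim (P := P) le_rfl)
      have h4 : ContMDiff 𝓘(ℝ, E) 𝓘(ℝ, F) ∞
          (fun x => (J x).symm (S.nablaExt P.W X (fun x => J x (f x)) x)) := by
        simp only [h2.eq_sum X, map_sum, map_smul]
        refine ContMDiff.sum fun i _ => ?_
        rw [P.contMDiff_iff]
        refine ContDiffOn.smul (P.contMDiff_iff.1 (X.contMDiff_rderiv
          ((P.contMDiff_g i).comp contMDiff_subtype_val))) (P.contMDiff_iff.1 (h3 i))
      have h5 := ih h4
      simpa only [LinearIsometryEquiv.apply_symm_apply] using h5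
  refine Set.mem_iInter.2 fun n => ?_
  cases n with
  | zero => exact (h1 0 hf).1
  | succ n => exact h1 n hf

theorem image_gammaInf :
    (fun (φ : ∀ x : P.W, H x) (x : P.W) => (J x).symm (φ x)) '' S.GammaInf P.W =
      {f : P.W → F | ContMDiff 𝓘(ℝ, E) 𝓘(ℝ, F) ∞ f} := by
  ext f
  constructor
  · rintro ⟨φ, hφ, rfl⟩
    exact hG.contMDiff_symm hJ (stable_gammaInf (P := P) le_rfl) ⟨φ, hφ, rfl⟩
  · intro hf
    exact ⟨_, mem_gammaInf_of_contMDiff hG hJ hf, by simp⟩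

end FlatFrame

variable [T2Space N] [SecondCountableTopology N]

/-- The inner product of two sections, the derivatives of which are given by a skew-symmetric
family of operators, is constant. -/
theorem inner_eq_of_horizontal {U : Opens N} (hU : P.W ≤ U) {φ ψ : ∀ x : U, H x}
    (hφ : φ ∈ S.GammaInf U) (hψ : ψ ∈ S.GammaInf U)
    (h : ∀ (Y : RealVect E U) (x : U), ⟪ψ x, S.nablaExt U (Vect.ofReal Y) φ x⟫_ℂ +
      ⟪S.nablaExt U (Vect.ofReal Y) ψ x, φ x⟫_ℂ = 0) (x x' : P.W) :
    ⟪ψ ⟨x, hU x.2⟩, φ ⟨x, hU x.2⟩⟫_ℂ = ⟪ψ ⟨x', hU x'.2⟩, φ ⟨x', hU x'.2⟩⟫_ℂ := by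
  have hd : ∀ y ∈ P.B, HasFDerivAt (fun y => ⟪ψ ⟨P.κ y, hU (P.κ y).2⟩,
      φ ⟨P.κ y, hU (P.κ y).2⟩⟫_ℂ) (0 : E →L[ℝ] ℂ) y := by
    intro y hy
    have h1 := ((isDeriv_nablaExt (Set.mem_iInter.1 hφ 1)).lim hU).hasFDerivAt_inner
      ((isDeriv_nablaExt (Set.mem_iInter.1 hψ 1)).lim hU) hy
    simp only [h] at h1
    simpa [Patch.grad] using h1
  obtain ⟨y, hy, rfl⟩ : ∃ y ∈ P.B, P.κ y = x := ⟨_, P.c_mem x, P.κ_c x⟩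
  obtain ⟨y', hy', rfl⟩ : ∃ y ∈ P.B, P.κ y = x' := ⟨_, P.c_mem x', P.κ_c x'⟩
  -- A function with zero derivative on the convex set `B` is constant.
  have h2 := P.convex_B.norm_image_sub_le_of_norm_hasFDerivWithin_le (C := 0)
    (fun y hy => (hd y hy).hasFDerivWithinAt) (by simp) hy' hy
  rwa [zero_mul, norm_le_zero_iff, sub_eq_zero] at h2

end SmoothField

end HilbertField

/-! ### The trivialization by horizontal sections. -/

theorem theorem2p9
    {E : Type*} [NormedAddCommGroup E] [NormedSpace ℝ E] [FiniteDimensional ℝ E]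
    {N : Type*} [TopologicalSpace N] [ChartedSpace E N] [IsManifold 𝓘(ℝ, E) ∞ N]
    [T2Space N] [SecondCountableTopology N] [ConnectedSpace N]
    {H : N → Type*} [∀ x, NormedAddCommGroup (H x)] [∀ x, InnerProductSpace ℂ (H x)]
    [∀ x, CompleteSpace (H x)]
    (S : HilbertField.SmoothField E N H)
    (hloc : ∀ p : N, ∃ U : Opens N, p ∈ U ∧
      ∃ (A : HilbertField.Vect E U → ∀ x : U, H x →ₗ.[ℂ] H x)
        (hA : ∀ X, S.IsSmoothOp U (A X)),
        -- the family is `C^∞(U)`-linear in the vector field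
        (∀ (X Y : HilbertField.Vect E U) (φ : S.GammaInf U),
          ((hA (X + Y)).map φ).1 = ((hA X).map φ).1 + ((hA Y).map φ).1) ∧
        (∀ (a : HilbertField.SmoothFun E U) (X : HilbertField.Vect E U) (φ : S.GammaInf U),
          ((hA (a • X)).map φ).1 = fun x => a x • ((hA X).map φ).1 x) ∧
        -- skew-symmetry
        (∀ (X : HilbertField.Vect E U) (φ ψ : S.GammaInf U) (x : U),
          ⟪ψ.1 x, ((hA X).map φ).1 x⟫_ℂ = ⟪-((hA X.conj).map ψ).1 x, φ.1 x⟫_ℂ) ∧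
        -- continuity for the topology induced by `Γ^n(U)`, `n = 1, 2, …`
        (∀ (X : HilbertField.Vect E U) (n : ℕ), 1 ≤ n →
          Continuous[S.topGamma U n, S.topGamma U n] (hA X).map) ∧
        -- horizontal sections through every point of `H|_U`
        (∀ (x : U) (v : H x), ∃ φ : S.GammaInf U, φ.1 x = v ∧
          ∀ X : HilbertField.Vect E U, S.nablaExt U X φ.1 = ((hA X).map φ).1)) :
    Nonempty (HilbertField.LocalTrivialization S) := by
  have hmain : ∀ p : N, ∃ (W : Opens N) (T : ∀ x : W, H x ≃ₗᵢ[ℂ] H p), p ∈ W ∧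
      (fun (φ : ∀ x : W, H x) (x : W) => T x (φ x)) '' S.GammaInf W =
        {f : W → H p | ContMDiff 𝓘(ℝ, E) 𝓘(ℝ, H p) ∞ f} := by
    intro p
    obtain ⟨U, hpU, A, hA, -, -, hskew, -, hhor⟩ := hloc p
    obtain ⟨P, hpW, hU⟩ := HilbertField.exists_patch (Module.finBasis ℝ E) p U hpU
    have hconst : ∀ φ ψ : S.GammaInf U,
        (∀ X, S.nablaExt U X φ.1 = ((hA X).map φ).1) →
        (∀ X, S.nablaExt U X ψ.1 = ((hA X).map ψ).1) → ∀ x x' : P.W,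
        ⟪ψ.1 ⟨x, hU x.2⟩, φ.1 ⟨x, hU x.2⟩⟫_ℂ = ⟪ψ.1 ⟨x', hU x'.2⟩, φ.1 ⟨x', hU x'.2⟩⟫_ℂ := by
      intro φ ψ hφ hψ
      refine HilbertField.SmoothField.inner_eq_of_horizontal hU φ.2 ψ.2 fun Y x => ?_
      have h1 := hskew (HilbertField.Vect.ofReal Y) φ ψ x
      rw [HilbertField.Vect.conj_ofReal] at h1
      rw [hφ, hψ, h1, inner_neg_left, neg_add_cancel]
    -- No linearity of `v ↦ e v` is arranged; it follows, after evaluation at `x`, from preservation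
    -- of inner products and surjectivity.
    choose e he hehor using fun v : H p => hhor ⟨p, hpU⟩ v
    have hinner : ∀ (x : P.W) (v w : H p),
        ⟪(e v).1 ⟨x, hU x.2⟩, (e w).1 ⟨x, hU x.2⟩⟫_ℂ = ⟪v, w⟫_ℂ := by
      intro x v w
      rw [hconst (e w) (e v) (hehor w) (hehor v) x ⟨p, hpW⟩]
      exact congrArg₂ _ (he v) (he w)
    have hsurj : ∀ x : P.W, Function.Surjective fun v : H p => (e v).1 ⟨x, hU x.2⟩ := by
      intro x u
      obtain ⟨φ, hφ, hφhor⟩ := hhor ⟨x, hU x.2⟩ u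
      refine ⟨φ.1 ⟨p, hpU⟩, ?_⟩
      set v := φ.1 ⟨p, hpU⟩ with hv
      -- `‖e_v(x) - u‖²` expands into four inner products of horizontal sections. Each equals its
      -- value at `p`, where both sections have the value `v`.
      rw [← sub_eq_zero, ← inner_self_eq_zero (𝕜 := ℂ)]
      have h1 := hconst (e v) φ (hehor v) hφhor x ⟨p, hpW⟩
      have h2 := hconst φ (e v) hφhor (hehor v) x ⟨p, hpW⟩
      have h3 := hconst φ φ hφhor hφhor x ⟨p, hpW⟩
      have h4 := hinner x v v
      rw [he] at h1 h2
      rw [hφ] at h1 h2 h3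
      simp only [inner_sub_left, inner_sub_right]
      rw [h1, h2, h3, h4]
      simp [hv]
    choose J hJ using fun x : P.W =>
      HilbertField.exists_linearIsometryEquiv _ (hinner x) (hsurj x)
    refine ⟨P.W, fun x => (J x).symm, hpW, ?_⟩
    -- The stable class containing the frame consists of the restrictions to `W` of `Γ^∞(U)`, where
    -- the horizontal sections live.
    refine HilbertField.SmoothField.image_gammaInf (HilbertField.SmoothField.stable_gammaInf hU)
      fun v => ⟨(e v).1, (e v).2, ?_⟩
    ext x
    exact (hJ x v).symm
  choose W T hpW hT using hmain
  exact ⟨{ ι := N, U := W, cover := fun x => ⟨x, hpW x⟩, F := H, T := T, image_eq := hT }⟩
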